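/- **Setting.** Let $G=(V,E)$ be a finite simple undirected graph (possibly disconnected) with $n\ge 1$ vertices, called processes, one of them being the distinguished root $r$. Each edge $\{u,v\}$ has a real weight $\omega(u,v)>0$. Each process $u$ designates its neighbors by pairwise distinct local labels taken from a non-empty set $Lbl$; we write $v$ also for the label of the neighbor $v$, and $\Gamma(u)$ for the set of (labels of) neighbors of $u$. Let $V_u$ be the vertex set of the connected component of $u$; let $d(u,v)\in[0,\infty]$ be the minimum weight of a path from $u$ to $v$ ($\infty$ if there is none); let $n_{\mathrm{maxCC}}$ be the maximum number of non-root processes in a connected component of $G$; and let $W_{\max}=\max_{e\in E}\omega(e)$ ($0$ if $E=\emptyset$). **Algorithm RSP.** Each non-root process $u$ has variables $st_u\in\{I,C,EB,EF\}$, $par_u\in Lbl$, $d_u\in[0,\infty)$; at the root these are constants, $st_r=C$, $par_r=\bot\notin Lbl$, $d_r=0$. A configuration assigns values to all variables. Define - $children(u)=\{v\in\Gamma(u): st_u\ne I,\ st_v\neq I,\ par_v=u,\ d_v\ge d_u+\omega(v,u),\ (st_v=st_u\text{ or }st_u=EB)\}$; - $abRoot(u)$: $st_u\ne I$ and [$par_u\notin\Gamma(u)$,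 or $st_{par_u}=I$, or $d_u<d_{par_u}+\omega(u,par_u)$, or ($st_u\ne st_{par_u}$ and $st_{par_u}\neq EB$)]; - $P\_reset(u)$: $st_u=EF$ and $abRoot(u)$; - $P\_correction(u)$: some $v\in\Gamma(u)$ has $st_v=C$ and $d_v+\omega(u,v)<d_u$; - $computePath(u)$: set $par_u$ to some $v\in\Gamma(u)$ with $st_v=C$ that minimizes $d_v+\omega(u,v)$ among such neighbors (ties broken arbitrarily), set $d_u$ to this minimum and $st_u$ to $C$. The rules of a non-root process $u$ are (the root has none): - $R_C$: if $st_u=C$ and $P\_correction(u)$, then $computePath(u)$; - $R_{EB}$: if $st_u=C$, not $P\_correction(u)$, and ($abRoot(u)$ or $st_{par_u}=EB$), then $st_u:=EB$; - $R_{EF}$: if $st_u=EB$ and $st_v=EF$ for all $v\in children(u)$, then $st_u:=EF$; - $R_I$: if $P\_reset(u)$ and $st_v\ne C$ for all $v\in\Gamma(u)$, then $st_u:=I$; - $R_R$: if ($P\_reset(u)$ or $st_u=I$) and $st_v=C$ for some $v\in\Gamma(u)$, then $computePath(u)$. A process is enabled if the guard of one of its rules holds; a configuration is terminal if no process is enabled.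 In a step, every process of some non-empty set of enabled processes simultaneously executes one of its enabled rules. An execution is a sequence of configurations, starting anywhere, whose consecutive configurations are related by steps, and which is infinite or ends in a terminal configuration. The distributed unfair daemon allows all executions. The stabilization time in steps is the maximum number of steps of an execution. A configuration is legitimate if every $u\in V_r\setminus\{r\}$ satisfies $st_u=C$, $d_u=d(u,r)$, $par_u\in\Gamma(u)$ and $d_u=d_{par_u}+\omega(u,par_u)$, and every $u\notin V_r$ satisfies $st_u=I$. Let $\mathcal{LC}_{RSP}$ be the set of legitimate configurations. **Theorem.** Algorithm RSP is silent self-stabilizing under the distributed unfair daemon for $\mathcal{LC}_{RSP}$: the set $\mathcal{LC}_{RSP}$ is non-empty, every execution is finite, and every terminal configuration is legitimate. In a legitimate configuration, the graph on $V_r$ with edges $\{u,par_u\}$, $u\in V_r\setminus\{r\}$, is a tree in which, for each $u\in V_r$, the path from $u$ to $r$ has weight $d(u,r)$ (a shortest-path tree of $V_r$ rooted at $r$), and all processes outside $V_r$ have status $I$. When moreover all edge weights are positive integers, the stabilization time in steps is at most $$\bigl[W_{\max}\,n_{\mathrm{maxCC}}^3+(3-W_{\max})\,n_{\mathrm{maxCC}}+3\bigr](n-1),$$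 and hence $O(W_{\max}\,n_{\mathrm{maxCC}}^3\,n)$: there is a universal constant $K$ such that it is at most $K\,W_{\max}\,n_{\mathrm{maxCC}}^3\,n$ whenever $G$ has at least one edge. -/

import Mathlib

open scoped NNReal ENNReal

namespace RSP

/-- A network: a simple undirected graph on the set `V` of processes, with a distinguished root,
strictly positive real edge weights, and a local labelling of neighbors: `label u v` is the label
by which `u` designates its neighbor `v`, and distinct neighbors of `u` have distinct labels at `u`.
Values of `weight` outside the edge set and of `label u v` for non-neighbors are never used. -/
structure Network (V : Type*) (Lbl : Type*) where
  graph : SimpleGraph V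
  root : V
  weight : Sym2 V → ℝ≥0
  weight_pos : ∀ e ∈ graph.edgeSet, 0 < weight e
  label : V → V → Lbl
  label_injOn : ∀ u, Set.InjOn (label u) (graph.neighborSet u)

/-- The four possible statuses: Isolated, Correct, Error Broadcast, Error Feedback. -/
inductive Status where
  | I
  | C
  | EB
  | EF

/-- The local state of a non-root process: status, parent pointer, distance value. -/
structure State (Lbl : Type*) where
  st : Status
  par : Lbl
  d : ℝ≥0

/-- The names of the five rules of the algorithm. -/
inductive Rule where
  | RC
  | REB
  | REF
  | RI
  | RR

namespace Network

variable {V Lbl : Type*} (N : Network V Lbl)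

/-! ### Graph quantities -/

/-- `ω(u,v)`. -/
def edgeWeight (u v : V) : ℝ≥0 := N.weight s(u, v)

/-- The connected component `V_u` of `u`. -/
def component (u : V) : Set V := {v | N.graph.Reachable u v}

/-- The sum of the weights of the edges of a walk. -/
def walkWeight {u v : V} (p : N.graph.Walk u v) : ℝ≥0 := (p.edges.map N.weight).sum

/-- The weighted distance: the minimum weight of a path, and `∞` if there is no path. -/
noncomputable def wdist (u v : V) : ℝ≥0∞ :=
  ⨅ p : N.graph.Path u v, (N.walkWeight (p : N.graph.Walk u v) : ℝ≥0∞)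

/-- The maximum number of non-root processes in a connected component. -/
noncomputable def nMaxCC [Fintype V] : ℕ :=
  Finset.univ.sup fun u : V => (N.component u \ {N.root}).ncard

/-- The maximum weight of an edge (`0` if there is no edge). -/
noncomputable def wMax [Fintype V] : ℝ≥0 :=
  (Set.toFinite N.graph.edgeSet).toFinset.sup N.weight

/-- `T` is a shortest-path tree, rooted at the root `r`, of the connected component of `r`: it is a
tree whose vertex set is this component, and for every vertex `u` of it the path from `u` to `r`
in `T` is a shortest path from `u` to `r` in the whole graph. -/
def IsShortestPathTree (T : N.graph.Subgraph) : Prop :=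
  T.verts = N.component N.root ∧ T.coe.IsTree ∧
    ∀ (u r : T.verts) (p : T.coe.Path u r), (r : V) = N.root →
      (N.walkWeight ((p : T.coe.Walk u r).map T.hom) : ℝ≥0∞) = N.wdist u r

/-! ### Configurations -/

/-- A non-root process. -/
abbrev NonRoot : Type _ := {u : V // u ≠ N.root}

/-- A configuration: the states of all processes. The variables of the root are constants,
so only the non-root processes contribute. -/
abbrev Config : Type _ := N.NonRoot → State Lbl

variable {N}

open Classical in
/-- `st_u`; the constant `C` at the root. -/
noncomputable def st (γ : N.Config) (u : V) : Status :=
  if h : u = N.root then Status.C else (γ ⟨u, h⟩).st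

open Classical in
/-- `par_u`; the constant `⊥`, which is different from every label, at the root. -/
noncomputable def par (γ : N.Config) (u : V) : WithBot Lbl :=
  if h : u = N.root then ⊥ else ((γ ⟨u, h⟩).par : WithBot Lbl)

open Classical in
/-- `d_u`; the constant `0` at the root. -/
noncomputable def d (γ : N.Config) (u : V) : ℝ≥0 :=
  if h : u = N.root then 0 else (γ ⟨u, h⟩).d

/-- The parent pointer of `u` designates the neighbor `v` of `u`. -/
def ParIs (γ : N.Config) (u v : V) : Prop :=
  N.graph.Adj u v ∧ par γ u = (N.label u v : WithBot Lbl)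

/-- The macro `children(u)`. -/
def children (γ : N.Config) (u : V) : Set V :=
  {v | N.graph.Adj u v ∧ st γ u ≠ Status.I ∧ st γ v ≠ Status.I ∧ ParIs γ v u ∧
    d γ u + N.edgeWeight v u ≤ d γ v ∧ (st γ v = st γ u ∨ st γ u = Status.EB)}

/-- The predicate `abRoot(u)`; the first disjunct says that the parent pointer of `u`
does not designate a neighbor of `u`. -/
def AbRoot (γ : N.Config) (u : V) : Prop :=
  st γ u ≠ Status.I ∧
    ((¬ ∃ v, ParIs γ u v) ∨
      ∃ v, ParIs γ u v ∧
        (st γ v = Status.I ∨ d γ u < d γ v + N.edgeWeight u v ∨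
          (st γ u ≠ st γ v ∧ st γ v ≠ Status.EB)))

/-- The predicate `P_reset(u)`. -/
def PReset (γ : N.Config) (u : V) : Prop := st γ u = Status.EF ∧ AbRoot γ u

/-- The predicate `P_correction(u)`. -/
def PCorrection (γ : N.Config) (u : V) : Prop :=
  ∃ v, N.graph.Adj u v ∧ st γ v = Status.C ∧ d γ v + N.edgeWeight u v < d γ u

/-- `s` is a possible result of the macro `computePath(u)`: the new parent is any neighbor `v` with
status `C` minimizing `d_v + ω(u,v)` among the neighbors with status `C`. -/
def ComputePath (γ : N.Config) (u : V) (s : State Lbl) : Prop :=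
  ∃ v, (N.graph.Adj u v ∧ st γ v = Status.C) ∧
    (∀ w, N.graph.Adj u w → st γ w = Status.C →
      d γ v + N.edgeWeight u v ≤ d γ w + N.edgeWeight u w) ∧
    s = ⟨Status.C, N.label u v, d γ v + N.edgeWeight u v⟩

/-- The guards of the five rules, at a non-root process. -/
def Guard (γ : N.Config) (u : N.NonRoot) : Rule → Prop
  | Rule.RC => st γ u = Status.C ∧ PCorrection γ u
  | Rule.REB => st γ u = Status.C ∧ ¬ PCorrection γ u ∧
      (AbRoot γ u ∨ ∃ v, ParIs γ u v ∧ st γ v = Status.EB)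
  | Rule.REF => st γ u = Status.EB ∧ ∀ v ∈ children γ u, st γ v = Status.EF
  | Rule.RI => PReset γ u ∧ ∀ v, N.graph.Adj u v → st γ v ≠ Status.C
  | Rule.RR => (PReset γ u ∨ st γ u = Status.I) ∧ ∃ v, N.graph.Adj u v ∧ st γ v = Status.C

/-- The actions of the five rules: `Action γ u ρ s` says that `s` is a possible state of `u` after
executing the action of `ρ` in `γ`. -/
def Action (γ : N.Config) (u : N.NonRoot) : Rule → State Lbl → Prop
  | Rule.RC, s => ComputePath γ u s
  | Rule.REB, s => s = { γ u with st := Status.EB }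
  | Rule.REF, s => s = { γ u with st := Status.EF }
  | Rule.RI, s => s = { γ u with st := Status.I }
  | Rule.RR, s => ComputePath γ u s

/-- A process is enabled if one of its rules is. The root has no rules. -/
def Enabled (γ : N.Config) (u : N.NonRoot) : Prop := ∃ ρ, Guard γ u ρ

/-- No process is enabled. -/
def Terminal (γ : N.Config) : Prop := ∀ u, ¬ Enabled γ u

/-- A step: each process of a non-empty set `X` of enabled processes executes one of its
enabled rules, all of them reading `γ`; the other processes do not change. -/
def Step (γ γ' : N.Config) : Prop :=
  ∃ X : Set N.NonRoot, X.Nonempty ∧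
    (∀ u ∈ X, ∃ ρ, Guard γ u ρ ∧ Action γ u ρ (γ' u)) ∧ ∀ u ∉ X, γ' u = γ u

variable (N)

/-- An execution: a maximal sequence of configurations `conf 0, conf 1, …` in which successive
configurations are related by a step. It has `length ∈ ℕ ∪ {∞}` steps; only the entries `conf i`
with `i ≤ length` belong to it. It is infinite, or its last configuration is terminal. -/
structure Execution where
  length : ℕ∞
  conf : ℕ → N.Config
  step : ∀ i : ℕ, (i : ℕ∞) < length → Step (conf i) (conf (i + 1))
  maximal : ∀ k : ℕ, length = k → Terminal (conf k)

/-- A daemon is a predicate over executions. -/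
abbrev Daemon : Type _ := N.Execution → Prop

/-- The distributed unfair daemon allows every execution. -/
def distributedUnfair : N.Daemon := fun _ => True

variable {N}

/-- Silent self-stabilization under the daemon `S` for the set `L` of legitimate configurations. -/
def SilentSelfStabilizing (S : N.Daemon) (L : Set N.Config) : Prop :=
  L.Nonempty ∧ (∀ e : N.Execution, S e → e.length ≠ ⊤) ∧ ∀ γ : N.Config, Terminal γ → γ ∈ L

/-- The stabilization time in steps: the maximum number of steps of the executions under `S`. -/
noncomputable def stabilizationTime (S : N.Daemon) : ℕ∞ :=
  ⨆ (e : N.Execution) (_ : S e), e.length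

/-! ### Legitimate configurations -/

/-- `u` is in a legitimate state. -/
def LegitimateState (γ : N.Config) (u : V) : Prop :=
  u = N.root ∨
  (u ≠ N.root ∧ u ∈ N.component N.root ∧ st γ u = Status.C ∧ (d γ u : ℝ≥0∞) = N.wdist u N.root ∧
    ∃ v, ParIs γ u v ∧ d γ u = d γ v + N.edgeWeight u v) ∨
  (u ∉ N.component N.root ∧ st γ u = Status.I)

variable (N)

/-- The set of legitimate configurations. -/
def legitimate : Set N.Config := {γ | ∀ u, LegitimateState γ u}

variable {N}

/-- The subgraph with vertex set `V_r` whose edges are the `{p,q}` such that `p` is in `V_r`, is not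
the root, and has the neighbor `q` as its parent. -/
def parentGraph (γ : N.Config) : N.graph.Subgraph where
  verts := N.component N.root
  Adj p q := (p ∈ N.component N.root ∧ p ≠ N.root ∧ ParIs γ p q) ∨
    (q ∈ N.component N.root ∧ q ≠ N.root ∧ ParIs γ q p)
  adj_sub := by
    rintro p q (⟨_, _, h, _⟩ | ⟨_, _, h, _⟩)
    · exact h
    · exact h.symm
  edge_vert := by
    rintro p q (⟨h, _⟩ | ⟨h, _, hq, _⟩)
    · exact h
    · exact SimpleGraph.Reachable.trans h hq.reachable
  symm := ⟨fun _ _ h => h.symm⟩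

end Network

end RSP

/-! The potential behind termination is the set of alive abnormal roots: non-root abnormal roots of
status `C` or `EB`. No step creates one (`Step.alive_of_alive`), so in each connected component this
set only shrinks. Every process `u` thus sees at most `compSize u + 1` phases, indexed by `level`,
during which the set is constant.

Inside a phase two mechanisms limit a process. A process of status `EB` is frozen: its parent chain
ends at an alive abnormal root of status `EB`, which persists, so the process can only go on to `EF`
and can neither reset nor compute before the phase ends (`Frozen.step`). Hence it enters `EB`, `EF`
and `I` at most once each. After a first `computePath`, a process stays live, and each further
computation strictly lowers its distance; its moves are therefore counted by the values it can take.
Each such value is a distance from the start of the phase, or the root's 0, plus the weights of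
edges along which it was propagated. No process occurs twice in that propagation (`Sourced.notMem`),
so the number of edges is bounded by the component size and the values form a finite set.

Summing over phases bounds the moves of each process (`IsRun.card_moves_le`), and each step moves
some process, so every execution is finite, whatever the weights. For integer weights at most
`W_max`, a sum of at most `k` weights takes at most `k * W_max` values, which gives the polynomial
bound.

In a terminal configuration `EB` and `EF` are impossible, status `C` fills exactly the root's
component, and the distances satisfy the shortest-path equations (`Terminal.legitimate`). Existence
of a terminal configuration, hence of a legitimate one, follows from termination. -/

namespace RSP
namespace Network

variable {V Lbl : Type*} {N : Network V Lbl} {γ γ' γ₀ : N.Config} {u v w x c : V}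

/-! ### Elementary facts -/

theorem st_root (γ : N.Config) : st γ N.root = Status.C := by simp [st]

theorem d_root (γ : N.Config) : d γ N.root = 0 := by simp [d]

theorem st_coe (γ : N.Config) (u : N.NonRoot) : st γ u = (γ u).st := by
  simp [st, u.2]

theorem d_coe (γ : N.Config) (u : N.NonRoot) : d γ u = (γ u).d := by
  simp [d, u.2]

theorem par_coe (γ : N.Config) (u : N.NonRoot) : par γ u = ((γ u).par : WithBot Lbl) := by
  simp [par, u.2]

theorem not_parIs_root : ¬ ParIs γ N.root v := by
  rintro ⟨-, h⟩
  simp [par] at h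

theorem ParIs.ne_root (h : ParIs γ u v) : u ≠ N.root := by
  rintro rfl
  exact not_parIs_root h

theorem ParIs.unique (h : ParIs γ u v) (h' : ParIs γ u w) : v = w :=
  N.label_injOn u h.1 h'.1 (WithBot.coe_injective (h.2.symm.trans h'.2))

theorem ParIs.of_par_eq (h : ParIs γ u v) (he : par γ' u = par γ u) : ParIs γ' u v :=
  ⟨h.1, he.trans h.2⟩

theorem edgeWeight_comm (N : Network V Lbl) (u v : V) : N.edgeWeight u v = N.edgeWeight v u := by
  simp [edgeWeight, Sym2.eq_swap]

theorem edgeWeight_pos (h : N.graph.Adj u v) : 0 < N.edgeWeight u v :=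
  N.weight_pos _ h

/-- The positive form of coherence with the parent; the proofs below use this rather than the
disjunctions of `AbRoot`. -/
theorem not_abRoot_iff (h : st γ u ≠ Status.I) :
    ¬ AbRoot γ u ↔ ∃ v, ParIs γ u v ∧ st γ v ≠ Status.I ∧ d γ v + N.edgeWeight u v ≤ d γ u ∧
      (st γ u = st γ v ∨ st γ v = Status.EB) := by
  constructor
  · intro hn
    by_contra hc
    refine hn ⟨h, ?_⟩
    by_cases hp : ∃ v, ParIs γ u v
    · obtain ⟨v, hv⟩ := hp
      refine Or.inr ⟨v, hv, ?_⟩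
      by_contra h'
      push Not at h'
      refine hc ⟨v, hv, h'.1, h'.2.1, ?_⟩
      by_cases he : st γ u = st γ v
      · exact Or.inl he
      · exact Or.inr (h'.2.2 he)
    · exact Or.inl hp
  · rintro ⟨v, hv, h1, h2, h3⟩ ⟨-, h4 | ⟨w, hw, h5⟩⟩
    · exact h4 ⟨v, hv⟩
    · obtain rfl := hv.unique hw
      rcases h5 with h5 | h5 | ⟨h5, h6⟩
      · exact h1 h5
      · exact absurd h2 (not_le.2 h5)
      · exact h3.elim h5 h6

/-- What a process can do in a step. -/
inductive Move (γ γ' : N.Config) (u : V) : Prop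
  | stay (hst : st γ' u = st γ u) (hpar : par γ' u = par γ u) (hd : d γ' u = d γ u)
  | compute (v : V) (hadj : N.graph.Adj u v) (hv : st γ v = Status.C) (hst' : st γ' u = Status.C)
      (hpar : ParIs γ' u v) (hd : d γ' u = d γ v + N.edgeWeight u v)
      (hlt : st γ u = Status.C → d γ' u < d γ u)
      (hor : st γ u ≠ Status.C → PReset γ u ∨ st γ u = Status.I)
  | eb (hst : st γ u = Status.C) (hst' : st γ' u = Status.EB) (hpar : par γ' u = par γ u)
      (hd : d γ' u = d γ u) (hor : AbRoot γ u ∨ ∃ v, ParIs γ u v ∧ st γ v = Status.EB)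
  | ef (hst : st γ u = Status.EB) (hst' : st γ' u = Status.EF) (hpar : par γ' u = par γ u)
      (hd : d γ' u = d γ u) (hch : ∀ v ∈ children γ u, st γ v = Status.EF)
  | ri (hre : PReset γ u) (hst' : st γ' u = Status.I)

theorem ComputePath.spec {u : N.NonRoot} (h : ComputePath γ u (γ' u)) :
    ∃ v, N.graph.Adj u v ∧ st γ v = Status.C ∧ st γ' u = Status.C ∧ ParIs γ' u v ∧
      d γ' u = d γ v + N.edgeWeight u v ∧
      ∀ w, N.graph.Adj u w → st γ w = Status.C → d γ' u ≤ d γ w + N.edgeWeight u w := by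
  obtain ⟨v, ⟨h1, h2⟩, h3, h4⟩ := h
  have hd : d γ' u = d γ v + N.edgeWeight u v := by rw [d_coe, h4]
  refine ⟨v, h1, h2, by rw [st_coe, h4], ⟨h1, by rw [par_coe, h4]⟩, hd, ?_⟩
  rwa [hd]

theorem Step.move (h : Step γ γ') (u : V) : Move γ γ' u := by
  obtain ⟨X, -, hX, hX'⟩ := h
  by_cases hu : u = N.root
  · subst hu
    exact .stay (by simp [st_root]) (by simp [par]) (by simp [d_root])
  obtain ⟨u, rfl⟩ : ∃ u' : N.NonRoot, u = u' := ⟨⟨u, hu⟩, rfl⟩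
  by_cases hm : u ∈ X
  · obtain ⟨ρ, hg, ha⟩ := hX u hm
    cases ρ with
    | RC =>
      obtain ⟨v, h1, h2, h3, h4, h5, h6⟩ := ComputePath.spec ha
      refine .compute v h1 h2 h3 h4 h5 (fun _ => ?_) (fun hc => absurd hg.1 hc)
      obtain ⟨w, hw, hw', hlt⟩ := hg.2
      exact (h6 w hw hw').trans_lt hlt
    | REB =>
      have ha : γ' u = { γ u with st := Status.EB } := ha
      exact .eb hg.1 (by rw [st_coe, ha]) (by simp only [par_coe, ha]) (by simp only [d_coe, ha])
        hg.2.2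
    | REF =>
      have ha : γ' u = { γ u with st := Status.EF } := ha
      exact .ef hg.1 (by rw [st_coe, ha]) (by simp only [par_coe, ha]) (by simp only [d_coe, ha])
        hg.2
    | RI =>
      have ha : γ' u = { γ u with st := Status.I } := ha
      exact .ri hg.1 (by rw [st_coe, ha])
    | RR =>
      obtain ⟨v, h1, h2, h3, h4, h5, -⟩ := ComputePath.spec ha
      refine .compute v h1 h2 h3 h4 h5 (fun hc => ?_) (fun _ => hg.1)
      rcases hg.1 with hg | hg
      · simp [hg.1] at hc
      · simp [hg] at hc
  · have he := hX' u hm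
    exact .stay (by simp only [st_coe, he]) (by simp only [par_coe, he]) (by simp only [d_coe, he])

/-- A process that executes a rule changes its state. -/
theorem Step.exists_ne (h : Step γ γ') : ∃ u, γ' u ≠ γ u := by
  obtain ⟨X, ⟨u, hu⟩, hX, -⟩ := h
  refine ⟨u, fun he => ?_⟩
  obtain ⟨ρ, hg, ha⟩ := hX u hu
  have hst : st γ' u = st γ u := by simp only [st_coe, he]
  have hd : d γ' u = d γ u := by simp only [d_coe, he]
  cases ρ with
  | RC =>
    obtain ⟨v, h1, h2, h3, h4, h5, h6⟩ := ComputePath.spec ha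
    obtain ⟨w, hw, hw', hlt⟩ := hg.2
    exact absurd ((h6 w hw hw').trans_lt hlt) (by simp [hd])
  | REB =>
    have ha : γ' u = { γ u with st := Status.EB } := ha
    have := hg.1
    rw [← hst, st_coe, ha] at this
    simp at this
  | REF =>
    have ha : γ' u = { γ u with st := Status.EF } := ha
    have := hg.1
    rw [← hst, st_coe, ha] at this
    simp at this
  | RI =>
    have ha : γ' u = { γ u with st := Status.I } := ha
    have := hg.1.1
    rw [← hst, st_coe, ha] at this
    simp at this
  | RR =>
    obtain ⟨v, h1, h2, h3, h4, h5, -⟩ := ComputePath.spec ha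
    rw [hst] at h3
    rcases hg.1 with hg | hg
    · simp [hg.1] at h3
    · simp [hg] at h3

/-- A process that changes its state enters one of the statuses by the corresponding rule. -/
theorem Step.move_of_ne (h : Step γ γ') {u : N.NonRoot} (hne : γ' u ≠ γ u) :
    (st γ u = Status.C ∧ st γ' u = Status.EB) ∨ (st γ u = Status.EB ∧ st γ' u = Status.EF) ∨
      (PReset γ u ∧ st γ' u = Status.I) ∨
      ∃ v, N.graph.Adj u v ∧ st γ v = Status.C ∧ st γ' u = Status.C ∧ ParIs γ' u v ∧
        d γ' u = d γ v + N.edgeWeight u v ∧ (st γ u = Status.C → d γ' u < d γ u) ∧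
        (st γ u ≠ Status.C → PReset γ u ∨ st γ u = Status.I) := by
  cases h.move u with
  | stay hst hpar hd =>
    refine absurd ?_ hne
    rw [st_coe, st_coe] at hst
    rw [d_coe, d_coe] at hd
    rw [par_coe, par_coe, WithBot.coe_inj] at hpar
    rcases h1 : γ' u with ⟨a, b, c⟩
    rcases h2 : γ u with ⟨a', b', c'⟩
    simp_all
  | compute v h1 h2 h3 h4 h5 h6 h7 => exact .inr (.inr (.inr ⟨v, h1, h2, h3, h4, h5, h6, h7⟩))
  | eb h1 h2 => exact .inl ⟨h1, h2⟩
  | ef h1 h2 => exact .inr (.inl ⟨h1, h2⟩)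
  | ri h1 h2 => exact .inr (.inr (.inl ⟨h1, h2⟩))

/-! ### Alive abnormal roots -/

/-- A non-root process that is an abnormal root of status `C` or `EB`. -/
def Alive (γ : N.Config) (u : V) : Prop :=
  u ≠ N.root ∧ AbRoot γ u ∧ (st γ u = Status.C ∨ st γ u = Status.EB)

/-- A process of status `C` does not increase its distance, and becomes at most `EB`. -/
theorem Step.of_st_C (h : Step γ γ') (hv : st γ v = Status.C) :
    d γ' v ≤ d γ v ∧ (st γ' v = Status.C ∨ st γ' v = Status.EB) := by
  cases h.move v with
  | stay hst hpar hd => exact ⟨hd.le, .inl (hst.trans hv)⟩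
  | compute w _ _ h1 _ _ h2 _ => exact ⟨(h2 hv).le, .inl h1⟩
  | eb _ h1 _ h2 => exact ⟨h2.le, .inr h1⟩
  | ef h1 => simp [h1] at hv
  | ri h1 => simp [h1.1] at hv

/-- A process of status `EB` keeps its distance and parent, and it becomes `EF` only if all its
children are. -/
theorem Step.of_st_EB (h : Step γ γ') (hv : st γ v = Status.EB) :
    d γ' v = d γ v ∧ par γ' v = par γ v ∧ (st γ' v = Status.EB ∨
      st γ' v = Status.EF ∧ ∀ u ∈ children γ v, st γ u = Status.EF) := by
  cases h.move v with
  | stay hst hpar hd => exact ⟨hd, hpar, .inl (hst.trans hv)⟩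
  | compute w _ _ h1 _ _ _ h2 =>
    rcases h2 (by simp [hv]) with h2 | h2
    · simp [h2.1] at hv
    · simp [h2] at hv
  | eb h1 => simp [h1] at hv
  | ef _ h1 h2 h3 h4 => exact ⟨h3, h2, .inr ⟨h1, h4⟩⟩
  | ri h1 => simp [h1.1] at hv

/-- A process of status `EF` that is not an abnormal root does not change. -/
theorem Step.of_st_EF (h : Step γ γ') (hv : st γ v = Status.EF) (ha : ¬ AbRoot γ v) :
    d γ' v = d γ v ∧ par γ' v = par γ v ∧ st γ' v = Status.EF := by
  cases h.move v with
  | stay hst hpar hd => exact ⟨hd, hpar, hst.trans hv⟩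
  | compute w _ _ h1 _ _ _ h2 =>
    rcases h2 (by simp [hv]) with h2 | h2
    · exact absurd h2.2 ha
    · simp [h2] at hv
  | eb h1 => simp [h1] at hv
  | ef h1 => simp [h1] at hv
  | ri h1 => exact absurd h1.2 ha

/-- A process that has just computed its path is not an abnormal root. -/
theorem Step.not_abRoot_of_compute (h : Step γ γ') (hv : st γ v = Status.C)
    (hu : st γ' u = Status.C) (hp : ParIs γ' u v) (hd : d γ' u = d γ v + N.edgeWeight u v) :
    ¬ AbRoot γ' u := by
  obtain ⟨h1, h2⟩ := h.of_st_C hv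
  refine (not_abRoot_iff (by simp [hu])).2 ⟨v, hp, ?_, ?_, ?_⟩
  · rcases h2 with h2 | h2 <;> simp [h2]
  · rw [hd]; gcongr
  · rcases h2 with h2 | h2 <;> simp [h2, hu]

/-- This ties the two local views together: a coherent process is seen by its parent, so it delays
the parent's rule `REF` until it has itself reached `EF`. -/
theorem mem_children_of_not_abRoot (hp : ParIs γ u v) (hu : st γ u ≠ Status.I)
    (ha : ¬ AbRoot γ u) : u ∈ children γ v := by
  obtain ⟨w, hw, h1, h2, h3⟩ := (not_abRoot_iff hu).1 ha
  obtain rfl := hp.unique hw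
  exact ⟨hp.1.symm, h1, hu, hp, h2, h3⟩

/-- No alive abnormal root is created. -/
theorem Step.alive_of_alive (h : Step γ γ') (hu : Alive γ' u) : Alive γ u := by
  obtain ⟨hr, hab, hst⟩ := hu
  refine ⟨hr, ?_⟩
  by_contra hcon
  -- A coherent process that keeps its parent and distance stays coherent. A parent of status `EB`
  -- cannot pass to `EF`, since `u` is a child not in `EF`; a parent of status `C` does not raise
  -- its distance and stays in `C` or `EB`.
  have key : ∀ v, ParIs γ u v → ¬ AbRoot γ u → (st γ u = Status.C ∨ st γ u = Status.EB) →
      (st γ' u = st γ u ∨ st γ' u = Status.EB ∧ st γ v = Status.EB) →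
      par γ' u = par γ u → d γ' u = d γ u → False := by
    intro v hp hna hs hs' hpar hd
    have hI : st γ u ≠ Status.I := by rcases hs with hs | hs <;> simp [hs]
    have hI' : st γ' u ≠ Status.I := by rcases hst with hs | hs <;> simp [hs]
    obtain ⟨v', hv, h1, h2, h3⟩ := (not_abRoot_iff hI).1 hna
    obtain rfl := hp.unique hv
    refine (not_abRoot_iff hI').2 ⟨v, hv.of_par_eq hpar, ?_⟩ hab
    by_cases hvb : st γ v = Status.EB
    · obtain ⟨h4, -, h5⟩ := h.of_st_EB hvb
      have h5 : st γ' v = Status.EB := by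
        refine h5.resolve_right fun h5 => ?_
        have := h5.2 u (mem_children_of_not_abRoot hp hI hna)
        rcases hs with hs | hs <;> simp [hs] at this
      exact ⟨by simp [h5], by rwa [h4, hd], .inr h5⟩
    · have huv := h3.resolve_right hvb
      have hvC : st γ v = Status.C := by
        rcases hs with hs | hs
        · rw [← huv, hs]
        · exact absurd (huv.symm.trans hs) hvb
      obtain ⟨h4, h5⟩ := h.of_st_C hvC
      refine ⟨by rcases h5 with h5 | h5 <;> simp [h5], ?_, ?_⟩
      · rw [hd]; exact le_trans (by gcongr) h2
      · rcases h5 with h5 | h5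
        · have : st γ' u = st γ u := hs'.resolve_right fun h => hvb h.2
          left; rw [this, huv, h5, hvC]
        · exact .inr h5
  cases h.move u with
  | stay hst' hpar hd =>
    rw [hst'] at hst
    have hna : ¬ AbRoot γ u := fun h => hcon ⟨h, hst⟩
    have hI : st γ u ≠ Status.I := by rcases hst with hs | hs <;> simp [hs]
    obtain ⟨v, hv, -⟩ := (not_abRoot_iff hI).1 hna
    exact key v hv hna hst (.inl hst') hpar hd
  | compute v _ hv hs hp hd => exact h.not_abRoot_of_compute hv hs hp hd hab
  | eb h1 h2 hpar hd hor =>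
    have hna : ¬ AbRoot γ u := fun h => hcon ⟨h, .inl h1⟩
    obtain ⟨v, hv, hv'⟩ := hor.resolve_left hna
    exact key v hv hna (.inl h1) (.inr ⟨h2, hv'⟩) hpar hd
  | ef _ h1 => simp [h1] at hst
  | ri _ h1 => simp [h1] at hst

/-! ### Frozen processes -/

/-- A process is frozen if its chain of parents leads, through processes of status `EB` or `EF`,
to an alive abnormal root of status `EB`. -/
inductive Frozen (γ : N.Config) : V → Prop
  | alive {u : V} (ha : Alive γ u) (hu : st γ u = Status.EB) : Frozen γ u
  | child {u v : V} (ha : ¬ AbRoot γ u) (hu : st γ u = Status.EB ∨ st γ u = Status.EF)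
      (hp : ParIs γ u v) (hv : Frozen γ v) : Frozen γ u

theorem Frozen.st_eq (h : Frozen γ u) : st γ u = Status.EB ∨ st γ u = Status.EF := by
  cases h with
  | alive _ h => exact .inl h
  | child _ h => exact h

theorem Frozen.not_abRoot (h : Frozen γ u) (hu : st γ u = Status.EF) : ¬ AbRoot γ u := by
  cases h with
  | alive _ h => simp [h] at hu
  | child h => exact h

theorem Frozen.not_pReset (h : Frozen γ u) : ¬ PReset γ u := fun h' => h.not_abRoot h'.1 h'.2

theorem Frozen.exists_alive (h : Frozen γ u) : ∃ a, N.graph.Reachable u a ∧ Alive γ a := by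
  induction h with
  | alive ha _ => exact ⟨_, .rfl, ha⟩
  | child _ _ hp _ ih =>
    obtain ⟨a, h1, h2⟩ := ih
    exact ⟨a, hp.1.reachable.trans h1, h2⟩

/-- Strong induction on the distance variable over the finite set of processes. -/
theorem induction_d [Finite V] (γ : N.Config) {P : V → Prop}
    (h : ∀ u, (∀ v, d γ v < d γ u → P v) → P u) (u : V) : P u :=
  (Finite.wellFounded_of_trans_of_irrefl (InvImage (· < ·) (d γ))).induction u h

/-- Following parents strictly decreases the distance and, from a coherent `EB` process, only meets
`EB`; the chain must stop at an abnormal root, which is alive. -/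
theorem frozen_of_st_EB [Finite V] (hu : st γ u = Status.EB) : Frozen γ u := by
  revert hu
  refine induction_d γ (P := fun u => st γ u = Status.EB → Frozen γ u) (fun u ih hu => ?_) u
  by_cases ha : AbRoot γ u
  · refine .alive ⟨?_, ha, .inr hu⟩ hu
    rintro rfl
    simp [st_root] at hu
  · obtain ⟨v, hv, -, h2, h3⟩ := (not_abRoot_iff (by simp [hu])).1 ha
    refine .child ha (.inl hu) hv (ih v ?_ ?_)
    · exact (lt_add_of_pos_right _ (edgeWeight_pos hv.1)).trans_le h2
    · rcases h3 with h3 | h3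
      · rw [← h3, hu]
      · exact h3

theorem Frozen.move (hu : Frozen γ u) (h : Step γ γ') :
    d γ' u = d γ u ∧ par γ' u = par γ u ∧ (st γ' u = st γ u ∨ st γ u = Status.EB ∧
      st γ' u = Status.EF ∧ ∀ v ∈ children γ u, st γ v = Status.EF) := by
  rcases hu.st_eq with hs | hs
  · obtain ⟨h1, h2, h3⟩ := h.of_st_EB hs
    refine ⟨h1, h2, ?_⟩
    rcases h3 with h3 | h3
    · exact .inl (by rw [h3, hs])
    · exact .inr ⟨hs, h3⟩
  · obtain ⟨h1, h2, h3⟩ := h.of_st_EF hs (hu.not_abRoot hs)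
    exact ⟨h1, h2, .inl (by rw [h3, hs])⟩

/-- No process connected to `c` stops being an alive abnormal root between `γ` and `γ'`. -/
def KeepsAlive (γ γ' : N.Config) (c : V) : Prop :=
  ∀ a, N.graph.Reachable c a → Alive γ a → Alive γ' a

/-- Along the chain statuses change only from `EB` to `EF`, and a parent does so only when its
children are already in `EF`, so each link stays coherent. The end of the chain stays alive by
assumption, hence in `EB`. -/
theorem Frozen.step {c : V} (hu : Frozen γ u) (h : Step γ γ') (hk : KeepsAlive γ γ' c)
    (hc : N.graph.Reachable c u) : Frozen γ' u := by
  induction hu with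
  | alive ha hu =>
    have ha' := hk _ hc ha
    refine .alive ha' ?_
    rcases (h.of_st_EB hu).2.2 with h1 | h1
    · exact h1
    · have := ha'.2.2
      simp [h1.1] at this
  | @child u v ha hu hp hv ih =>
    have hv' := ih (hc.trans hp.1.reachable)
    have hI : st γ u ≠ Status.I := by rcases hu with hs | hs <;> simp [hs]
    obtain ⟨w, hw, h1, h2, h3⟩ := (not_abRoot_iff hI).1 ha
    obtain rfl := hp.unique hw
    obtain ⟨hd, hpar, hs⟩ := (Frozen.child ha hu hp hv).move h
    obtain ⟨hdv, -, hsv⟩ := hv.move h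
    have hu' : st γ' u = Status.EB ∨ st γ' u = Status.EF := by
      rcases hs with hs | hs
      · rwa [hs]
      · exact .inr hs.2.1
    refine .child ?_ hu' (hp.of_par_eq hpar) hv'
    refine (not_abRoot_iff (by rcases hu' with hs | hs <;> simp [hs])).2
      ⟨v, hp.of_par_eq hpar, by rcases hv'.st_eq with hs | hs <;> simp [hs], by rwa [hd, hdv], ?_⟩
    rcases hsv with hsv | ⟨hvB, hvF, hch⟩
    · rcases hv.st_eq with hvs | hvs
      · exact .inr (hsv.trans hvs)
      · have huF : st γ u = Status.EF := by
          rcases h3 with h3 | h3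
          · rw [h3, hvs]
          · simp [h3] at hvs
        rcases hs with hs | hs
        · left; rw [hs, huF, hsv, hvs]
        · simp [huF] at hs
    · have huF := hch u (mem_children_of_not_abRoot hp hI ha)
      rcases hs with hs | hs
      · left; rw [hs, huF, hvF]
      · simp [huF] at hs

/-- A process is live if its status is `C` or if it is frozen. -/
def Live (γ : N.Config) (u : V) : Prop := st γ u = Status.C ∨ Frozen γ u

theorem Live.not_pReset (h : Live γ u) : ¬ PReset γ u := by
  rintro h'
  rcases h with h | h
  · simp [h'.1] at h
  · exact h.not_pReset h'

theorem Live.st_ne_I (h : Live γ u) : st γ u ≠ Status.I := by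
  rcases h with h | h
  · simp [h]
  · rcases h.st_eq with h | h <;> simp [h]

/-- Liveness is the invariant that excludes resets within a phase and makes distances monotone. -/
theorem Live.step [Finite V] {c : V} (hu : Live γ u) (h : Step γ γ') (hk : KeepsAlive γ γ' c)
    (hc : N.graph.Reachable c u) : Live γ' u ∧ d γ' u ≤ d γ u := by
  rcases hu with hu | hu
  · obtain ⟨h1, h2⟩ := h.of_st_C hu
    exact ⟨h2.imp_right frozen_of_st_EB, h1⟩
  · exact ⟨.inr (hu.step h hk hc), (hu.move h).1.le⟩

/-! ### Sums of edge weights -/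

variable (N) in
/-- The weights of the edges of the connected component of `c`. -/
def compWeights (c : V) : Set ℝ≥0 :=
  {a | ∃ v w, N.graph.Adj v w ∧ N.graph.Reachable c v ∧ a = N.edgeWeight v w}

variable (N) in
/-- The sums of at least one and at most `k` weights of edges of the connected component of `c`. -/
def weightSums (c : V) (k : ℕ) : Set ℝ≥0 :=
  {a | ∃ l : List ℝ≥0, 1 ≤ l.length ∧ l.length ≤ k ∧ (∀ b ∈ l, b ∈ N.compWeights c) ∧ a = l.sum}

theorem finite_compWeights [Finite V] (c : V) : (N.compWeights c).Finite :=
  (Set.finite_range fun p : V × V => N.edgeWeight p.1 p.2).subset <| by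
    rintro _ ⟨v, w, -, -, rfl⟩
    exact ⟨(v, w), rfl⟩

theorem finite_weightSums [Finite V] (c : V) (k : ℕ) : (N.weightSums c k).Finite := by
  have := (N.finite_compWeights c).to_subtype
  refine ((List.finite_length_le (N.compWeights c) k).image
    fun l => (l.map Subtype.val).sum).subset ?_
  rintro _ ⟨l, -, hl, hb, rfl⟩
  refine ⟨l.attach.map fun a => ⟨a.1, hb _ a.2⟩, by simpa using hl, ?_⟩
  simp [List.map_map, Function.comp_def]

/-! ### Sources of computed distances -/

/-- The distance of `u` in `γ` is the distance that the source `x` had in `γ₀` plus the weights of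
`|S| - 1` edges, where `S` is the set of the processes through which it was propagated. -/
structure Sourced (γ₀ γ : N.Config) (c u x : V) (S : Finset V) : Prop where
  source_mem : x ∈ S
  mem : u ∈ S
  reachable : ∀ z ∈ S, N.graph.Reachable c z
  live : ∀ z ∈ S, Live γ z
  le : ∀ z ∈ S, d γ z ≤ d γ u
  root : N.root ∈ S → x = N.root
  dist : ∃ l : List ℝ≥0, l.length + 1 = S.card ∧ (∀ b ∈ l, b ∈ N.compWeights c) ∧
    d γ u = d γ₀ x + l.sum

theorem Sourced.refl (hu : st γ u = Status.C) (hc : N.graph.Reachable c u) :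
    Sourced γ γ c u u {u} where
  source_mem := by simp
  mem := by simp
  reachable := by simpa using hc
  live := by simpa using .inl hu
  le := by simp
  root := by simp [eq_comm]
  dist := ⟨[], by simp⟩

/-- The members of `S` are live, so their distances can only drop while that of `u` is unchanged.
The sum recorded in `dist` refers to `γ₀` and is unaffected by later changes in `S`. -/
theorem Sourced.of_d_eq [Finite V] {S : Finset V} (hs : Sourced γ₀ γ c u x S) (h : Step γ γ')
    (hk : KeepsAlive γ γ' c) (hd : d γ' u = d γ u) : Sourced γ₀ γ' c u x S where
  source_mem := hs.source_mem
  mem := hs.mem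
  reachable := hs.reachable
  live z hz := ((hs.live z hz).step h hk (hs.reachable z hz)).1
  le z hz := ((hs.live z hz).step h hk (hs.reachable z hz)).2.trans ((hs.le z hz).trans hd.ge)
  root := hs.root
  dist := by rw [hd]; exact hs.dist

/-- The process `u` executes the macro `computePath`. -/
def Computes (γ γ' : N.Config) (u : V) : Prop :=
  ∃ v, N.graph.Adj u v ∧ st γ v = Status.C ∧ st γ' u = Status.C ∧ ParIs γ' u v ∧
    d γ' u = d γ v + N.edgeWeight u v ∧ (st γ u = Status.C → d γ' u < d γ u) ∧
    (st γ u ≠ Status.C → PReset γ u ∨ st γ u = Status.I)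

theorem Live.st_eq_of_computes (hu : Live γ u) (h : Computes γ γ' u) : st γ u = Status.C := by
  obtain ⟨v, -, -, -, -, -, -, h⟩ := h
  by_contra hc
  rcases h hc with h | h
  · exact hu.not_pReset h
  · exact hu.st_ne_I h

theorem Live.d_lt_of_computes (hu : Live γ u) (h : Computes γ γ' u) : d γ' u < d γ u := by
  have := hu.st_eq_of_computes h
  obtain ⟨v, -, -, -, -, -, h, -⟩ := h
  exact h this

/-- Were `u` in `S`, it would be live, so computing would strictly lower its distance, which was at
most `d γ v`; but the new value exceeds `d γ v` by a positive weight. -/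
theorem Sourced.notMem {S : Finset V} (hs : Sourced γ₀ γ c v x S)
    (hd : d γ' u = d γ v + N.edgeWeight u v) (hc : Computes γ γ' u) : u ∉ S := by
  intro hu
  have h1 := (hs.live u hu).d_lt_of_computes hc
  have h2 := hs.le u hu
  rw [hd] at h1
  exact absurd (h1.trans_le h2) (by simp)

open Classical in
theorem Sourced.extend [Finite V] {S : Finset V} (hs : Sourced γ₀ γ c v x S) (h : Step γ γ')
    (hk : KeepsAlive γ γ' c) (hp : ParIs γ' u v)
    (hd : d γ' u = d γ v + N.edgeWeight u v) (hc : Computes γ γ' u) :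
    Sourced γ₀ γ' c u x (insert u S) where
  source_mem := Finset.mem_insert_of_mem hs.source_mem
  mem := Finset.mem_insert_self _ _
  reachable := by
    rintro z hz
    rcases Finset.mem_insert.1 hz with rfl | hz
    · exact (hs.reachable v hs.mem).trans hp.1.symm.reachable
    · exact hs.reachable z hz
  live := by
    rintro z hz
    rcases Finset.mem_insert.1 hz with rfl | hz
    · obtain ⟨_, _, _, h1, _⟩ := hc
      exact .inl h1
    · exact ((hs.live z hz).step h hk (hs.reachable z hz)).1
  le := by
    rintro z hz
    rcases Finset.mem_insert.1 hz with rfl | hz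
    · exact le_rfl
    · rw [hd]
      exact ((hs.live z hz).step h hk (hs.reachable z hz)).2.trans
        ((hs.le z hz).trans le_self_add)
  root := by
    intro hr
    rcases Finset.mem_insert.1 hr with hr | hr
    · exact absurd hr.symm hp.ne_root
    · exact hs.root hr
  dist := by
    obtain ⟨l, h1, h2, h3⟩ := hs.dist
    refine ⟨N.edgeWeight u v :: l, ?_, ?_, ?_⟩
    · rw [Finset.card_insert_of_notMem (hs.notMem hd hc), ← h1, List.length_cons]
    · intro b hb
      rcases List.mem_cons.1 hb with rfl | hb
      · exact ⟨v, u, hp.1.symm, hs.reachable v hs.mem, edgeWeight_comm _ _ _⟩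
      · exact h2 b hb
    · rw [hd, h3, List.sum_cons]
      ring

/-- All distances of processes of status `C` in the component of `c` come from sources. -/
def AllSourced (γ₀ γ : N.Config) (c : V) : Prop :=
  ∀ u, N.graph.Reachable c u → st γ u = Status.C → ∃ x S, Sourced γ₀ γ c u x S

theorem AllSourced.refl (γ : N.Config) (c : V) : AllSourced γ γ c :=
  fun u hc hu => ⟨u, {u}, .refl hu hc⟩

theorem AllSourced.step [Finite V] (hs : AllSourced γ₀ γ c) (h : Step γ γ')
    (hk : KeepsAlive γ γ' c) : AllSourced γ₀ γ' c := by
  classical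
  intro u hc hu
  cases h.move u with
  | stay hst _ hd =>
    obtain ⟨x, S, hx⟩ := hs u hc (hst.symm.trans hu)
    exact ⟨x, S, hx.of_d_eq h hk hd⟩
  | compute v h1 h2 h3 h4 h5 h6 h7 =>
    obtain ⟨x, S, hx⟩ := hs v (hc.trans h1.reachable) h2
    exact ⟨x, _, hx.extend h hk h4 h5 ⟨v, h1, h2, h3, h4, h5, h6, h7⟩⟩
  | eb _ h1 => simp [h1] at hu
  | ef _ h1 => simp [h1] at hu
  | ri _ h1 => simp [h1] at hu

variable (N) in
/-- The number of non-root processes in the connected component of `c`. -/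
noncomputable def compSize (c : V) : ℕ := (N.component c \ {N.root}).ncard

/-- The values that `u` can compute, as long as the same alive abnormal roots remain as in `γ₀`. -/
def computedValues (γ₀ : N.Config) (u : V) : Set ℝ≥0 :=
  N.weightSums u (N.compSize u) ∪ ⋃ x ∈ (N.component u \ {N.root}) \ {u},
    (fun a => d γ₀ x + a) '' N.weightSums u (N.compSize u - 1)

theorem finite_computedValues [Finite V] (γ₀ : N.Config) (u : V) :
    (computedValues γ₀ u).Finite :=
  (finite_weightSums _ _).union <| (Set.toFinite _).biUnion fun _ _ => (finite_weightSums _ _).image _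

theorem ncard_computedValues_le [Finite V] (γ₀ : N.Config) (u : N.NonRoot) :
    (computedValues γ₀ u).ncard ≤ (N.compSize u - 1) * (N.weightSums u (N.compSize u - 1)).ncard +
      (N.weightSums u (N.compSize u)).ncard := by
  classical
  have h1 : (N.component u \ {N.root}) \ {(u : V)} = ((Set.toFinite
      ((N.component (u : V) \ {N.root}) \ {(u : V)})).toFinset : Set V) := by simp
  have h2 : ((Set.toFinite ((N.component (u : V) \ {N.root}) \ {(u : V)})).toFinset).card
      = N.compSize u - 1 := by
    rw [← Set.ncard_eq_toFinset_card, Set.ncard_sdiff_singleton_of_mem, compSize]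
    exact ⟨.rfl, u.2⟩
  rw [add_comm]
  refine (Set.ncard_union_le _ _).trans (Nat.add_le_add_left ?_ _)
  set A := N.weightSums (u : V) (N.compSize u - 1) with hA
  have hfin : A.Finite := finite_weightSums _ _
  have : (⋃ x ∈ (N.component u \ {N.root}) \ {(u : V)}, (fun a => d γ₀ x + a) '' A) =
      ((((Set.toFinite ((N.component (u : V) \ {N.root}) \ {(u : V)})).toFinset).biUnion
        fun x => hfin.toFinset.image fun a => d γ₀ x + a : Finset ℝ≥0) : Set ℝ≥0) := by
    ext a
    simp
  rw [this, Set.ncard_coe_finset, ← h2]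
  refine Finset.card_biUnion_le_card_mul _ _ _ fun x _ => ?_
  rw [Set.ncard_eq_toFinset_card _ hfin]
  exact Finset.card_image_le

theorem AllSourced.mem_computedValues [Finite V] (hs : AllSourced γ₀ γ u)
    (hc : Computes γ γ' u) : d γ' u ∈ computedValues γ₀ u := by
  classical
  obtain ⟨v, h1, h2, h3, h4, h5, h6, h7⟩ := id hc
  obtain ⟨x, S, hx⟩ := hs v h1.reachable h2
  have hu := hx.notMem h5 hc
  obtain ⟨l, hl, hb, hd⟩ := hx.dist
  have hcard : (N.edgeWeight u v :: l).length + 1 = (insert u S).card := by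
    rw [Finset.card_insert_of_notMem hu, ← hl, List.length_cons]
  have hb' : ∀ b ∈ N.edgeWeight u v :: l, b ∈ N.compWeights u := by
    intro b hb₁
    rcases List.mem_cons.1 hb₁ with rfl | hb₁
    · exact ⟨u, v, h1, .rfl, rfl⟩
    · exact hb b hb₁
  have hsum : d γ' u = d γ₀ x + (N.edgeWeight u v :: l).sum := by
    rw [h5, hd, List.sum_cons]
    ring
  have hsub : ((insert u S : Finset V) : Set V) ⊆ N.component u := by
    intro z hz
    rcases Finset.mem_insert.1 hz with rfl | hz
    · exact .refl _
    · exact hx.reachable z hz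
  by_cases hr : x = N.root
  · left
    refine ⟨_, by simp, ?_, hb', by rw [hsum, hr, d_root, zero_add]⟩
    -- With the root as source, the set may contain the root besides the non-root processes, so up
    -- to `compSize u` edges are possible.
    have : (insert u S).card ≤ N.compSize u + 1 := by
      rw [← Set.ncard_coe_finset]
      refine (Set.ncard_le_ncard (t := insert N.root (N.component u \ {N.root})) ?_).trans
        (Set.ncard_insert_le _ _)
      intro z hz
      by_cases hzr : z = N.root
      · exact .inl hzr
      · exact .inr ⟨hsub hz, hzr⟩
    omega
  · right
    refine Set.mem_iUnion₂.2 ⟨x, ⟨⟨hx.reachable x hx.source_mem, hr⟩, ?_⟩, _,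
      ⟨_, by simp, ?_, hb', rfl⟩, hsum.symm⟩
    · rintro rfl
      exact hu hx.source_mem
    -- With another source the root is not in the set at all, which saves one edge.
    have : (insert u S).card ≤ N.compSize u := by
      rw [← Set.ncard_coe_finset]
      refine Set.ncard_le_ncard fun z hz => ⟨hsub hz, ?_⟩
      rintro rfl
      rcases Finset.mem_insert.1 hz with hz | hz
      · exact h4.ne_root hz.symm
      · exact hr (hx.root hz)
    omega

/-! ### Phases: parts of a run in which the alive abnormal roots of a component are the same -/

/-- The alive abnormal roots in the connected component of `c`. -/
def aliveSet (γ : N.Config) (c : V) : Set V := {a | N.graph.Reachable c a ∧ Alive γ a}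

/-- The number of alive abnormal roots in the connected component of `c`. -/
noncomputable def level (γ : N.Config) (c : V) : ℕ := (aliveSet γ c).ncard

theorem aliveSet_subset (γ : N.Config) (c : V) : aliveSet γ c ⊆ N.component c \ {N.root} :=
  fun _ ha => ⟨ha.1, ha.2.1⟩

theorem level_le [Finite V] (γ : N.Config) (c : V) : level γ c ≤ N.compSize c :=
  Set.ncard_le_ncard (aliveSet_subset γ c)

theorem Frozen.level_pos [Finite V] (h : Frozen γ u) : 0 < level γ u := by
  obtain ⟨a, h1, h2⟩ := h.exists_alive
  exact (Set.ncard_pos (Set.toFinite (aliveSet γ u))).2 ⟨a, h1, h2⟩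

variable (N) in
/-- The configurations `conf 0, …, conf L` are related by steps. -/
def IsRun (conf : ℕ → N.Config) (L : ℕ) : Prop := ∀ i < L, Step (conf i) (conf (i + 1))

variable {conf : ℕ → N.Config} {L i j : ℕ}

theorem IsRun.aliveSet_anti (h : N.IsRun conf L) (hij : i ≤ j) (hj : j ≤ L) (c : V) :
    aliveSet (conf j) c ⊆ aliveSet (conf i) c := by
  induction j, hij using Nat.le_induction with
  | base => exact subset_rfl
  | succ j hij ih =>
    exact fun a ha => ih (by omega) ⟨ha.1, (h j (by omega)).alive_of_alive ha.2⟩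

theorem IsRun.level_anti [Finite V] (h : N.IsRun conf L) (hij : i ≤ j) (hj : j ≤ L) (c : V) :
    level (conf j) c ≤ level (conf i) c :=
  Set.ncard_le_ncard (h.aliveSet_anti hij hj c)

theorem IsRun.aliveSet_eq [Finite V] (h : N.IsRun conf L) (hij : i ≤ j) (hj : j ≤ L)
    (hl : level (conf i) c = level (conf j) c) : aliveSet (conf j) c = aliveSet (conf i) c :=
  Set.eq_of_subset_of_ncard_le (h.aliveSet_anti hij hj c) hl.le

/-- Properties preserved by the steps that keep alive abnormal roots are preserved in a phase. -/
theorem IsRun.phase_induction [Finite V] (h : N.IsRun conf L) {P : N.Config → Prop} (hij : i ≤ j)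
    (hj : j ≤ L) (hl : level (conf i) c = level (conf j) c)
    (hP : ∀ γ γ', Step γ γ' → KeepsAlive γ γ' c → P γ → P γ') (hi : P (conf i)) : P (conf j) := by
  induction j, hij using Nat.le_induction with
  | base => exact hi
  | succ j hij ih =>
    have h1 := h.level_anti hij (by omega) c
    have h2 : level (conf (j + 1)) c ≤ level (conf j) c := h.level_anti (Nat.le_succ j) hj c
    refine hP _ _ (h j (by omega)) (fun a hc ha => ?_) (ih (by omega) (by omega))
    have := h.aliveSet_eq (c := c) (Nat.le_add_right j 1) hj (by omega)
    exact (this.ge ⟨hc, ha⟩ : a ∈ aliveSet (conf (j + 1)) c).2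

/-- Monotonicity pinches the level just after step `i`, so the phase arguments can start from the
result of a move. -/
theorem IsRun.level_succ_eq [Finite V] (h : N.IsRun conf L) (hij : i < j) (hj : j ≤ L)
    (hl : level (conf i) c = level (conf j) c) :
    level (conf i) c = level (conf (i + 1)) c := by
  have h1 := h.level_anti (Nat.le_succ i) (by omega) c
  have h2 := h.level_anti (Nat.succ_le_of_lt hij) hj c
  exact le_antisymm (hl.trans_le h2) h1

theorem IsRun.frozen [Finite V] (h : N.IsRun conf L) (hij : i ≤ j) (hj : j ≤ L)
    (hl : level (conf i) u = level (conf j) u) (hu : Frozen (conf i) u) : Frozen (conf j) u :=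
  h.phase_induction (P := fun γ => Frozen γ u) hij hj hl
    (fun _ _ hs hk hf => hf.step hs hk .rfl) hu

theorem IsRun.frozen_EF [Finite V] (h : N.IsRun conf L) (hij : i ≤ j) (hj : j ≤ L)
    (hl : level (conf i) u = level (conf j) u) (hu : Frozen (conf i) u)
    (hs : st (conf i) u = Status.EF) : st (conf j) u = Status.EF := by
  refine (h.phase_induction (P := fun γ => Frozen γ u ∧ st γ u = Status.EF) hij hj hl
    (fun γ γ' hs hk hf => ⟨hf.1.step hs hk .rfl, ?_⟩) ⟨hu, hs⟩).2
  exact (hs.of_st_EF hf.2 (hf.1.not_abRoot hf.2)).2.2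

theorem IsRun.live [Finite V] (h : N.IsRun conf L) (hij : i ≤ j) (hj : j ≤ L)
    (hl : level (conf i) u = level (conf j) u) (hu : Live (conf i) u) :
    Live (conf j) u ∧ d (conf j) u ≤ d (conf i) u :=
  h.phase_induction (P := fun γ => Live γ u ∧ d γ u ≤ d (conf i) u) hij hj hl
    (fun _ _ hs hk hf => ⟨(hf.1.step hs hk .rfl).1, (hf.1.step hs hk .rfl).2.trans hf.2⟩)
    ⟨hu, le_rfl⟩

/-- From `I` the only exit is a computation, which leads to status `C`, and live processes remain
live in a phase. -/
theorem IsRun.st_I_or_live [Finite V] (h : N.IsRun conf L) (hij : i ≤ j) (hj : j ≤ L)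
    (hl : level (conf i) u = level (conf j) u) (hu : st (conf i) u = Status.I) :
    st (conf j) u = Status.I ∨ Live (conf j) u := by
  refine h.phase_induction (P := fun γ => st γ u = Status.I ∨ Live γ u) hij hj hl
    (fun γ γ' hs hk hf => ?_) (.inl hu)
  rcases hf with hf | hf
  · cases hs.move u with
    | stay h1 => exact .inl (h1.trans hf)
    | compute _ _ _ h1 => exact .inr (.inl h1)
    | eb h1 => simp [h1] at hf
    | ef h1 => simp [h1] at hf
    | ri h1 => simp [h1.1] at hf
  · exact .inr (hf.step hs hk .rfl).1

theorem IsRun.allSourced [Finite V] (h : N.IsRun conf L) (hij : i ≤ j) (hj : j ≤ L)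
    (hl : level (conf i) c = level (conf j) c) : AllSourced (conf i) (conf j) c :=
  h.phase_induction (P := fun γ => AllSourced (conf i) γ c) hij hj hl
    (fun _ _ hs hk hf => hf.step hs hk) (.refl _ _)

/-! ### Counting the moves of a process -/

theorem _root_.Finset.card_le_card_of_forall_lt_ne {α : Type*} {s : Finset ℕ} {t : Finset α}
    (f : ℕ → α) (hf : ∀ i ∈ s, f i ∈ t) (hne : ∀ i ∈ s, ∀ j ∈ s, i < j → f i ≠ f j) :
    s.card ≤ t.card := by
  refine Finset.card_le_card_of_injOn f hf fun i hi j hj he => ?_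
  rcases lt_trichotomy i j with h | h | h
  · exact absurd he (hne i hi j hj h)
  · exact h
  · exact absurd he.symm (hne j hj i hi h)

-- At most one such move per level: afterwards `u` is frozen and cannot be in `C` before the level
-- drops. Level 0 is excluded because a process in `EB` requires an alive abnormal root.
open Classical in
theorem IsRun.card_EB_le [Finite V] (h : N.IsRun conf L) (u : V) :
    ((Finset.range L).filter fun i => st (conf i) u = Status.C ∧
      st (conf (i + 1)) u = Status.EB).card ≤ N.compSize u := by
  refine (Finset.card_le_card_of_forall_lt_ne (t := Finset.Icc 1 (N.compSize u))
    (fun i => level (conf i) u) ?_ ?_).trans (by simp)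
  · intro i hi
    simp only [Finset.mem_filter, Finset.mem_range] at hi
    refine Finset.mem_Icc.2 ⟨?_, level_le _ _⟩
    exact (frozen_of_st_EB hi.2.2).level_pos.trans_le (h.level_anti (Nat.le_succ i) hi.1 u)
  · intro i hi j hj hij he
    simp only [Finset.mem_filter, Finset.mem_range] at hi hj
    have := h.frozen (Nat.succ_le_of_lt hij) hj.1.le
      ((h.level_succ_eq hij hj.1.le he).symm.trans he) (frozen_of_st_EB hi.2.2)
    rcases this.st_eq with h1 | h1 <;> simp [h1] at hj

open Classical in
theorem IsRun.card_EF_le [Finite V] (h : N.IsRun conf L) (u : V) :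
    ((Finset.range L).filter fun i => st (conf i) u = Status.EB ∧
      st (conf (i + 1)) u = Status.EF).card ≤ N.compSize u := by
  refine (Finset.card_le_card_of_forall_lt_ne (t := Finset.Icc 1 (N.compSize u))
    (fun i => level (conf i) u) ?_ ?_).trans (by simp)
  · intro i hi
    simp only [Finset.mem_filter, Finset.mem_range] at hi
    exact Finset.mem_Icc.2 ⟨(frozen_of_st_EB hi.2.1).level_pos, level_le _ _⟩
  · intro i hi j hj hij he
    simp only [Finset.mem_filter, Finset.mem_range] at hi hj
    have he' := h.level_succ_eq hij hj.1.le he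
    have h1 := h.frozen (Nat.le_succ i) hi.1 he' (frozen_of_st_EB hi.2.1)
    have := h.frozen_EF (Nat.succ_le_of_lt hij) hj.1.le (he'.symm.trans he) h1 hi.2.2
    simp [this] at hj

-- After a reset, `u` is isolated or live until the level drops, and neither allows another reset.
-- Level 0 can occur here, whence the extra 1.
open Classical in
theorem IsRun.card_I_le [Finite V] (h : N.IsRun conf L) (u : V) :
    ((Finset.range L).filter fun i => PReset (conf i) u ∧
      st (conf (i + 1)) u = Status.I).card ≤ N.compSize u + 1 := by
  refine (Finset.card_le_card_of_forall_lt_ne (t := Finset.range (N.compSize u + 1))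
    (fun i => level (conf i) u) ?_ ?_).trans (by simp)
  · intro i _
    exact Finset.mem_range.2 (Nat.lt_succ_of_le (level_le _ _))
  · intro i hi j hj hij he
    simp only [Finset.mem_filter, Finset.mem_range] at hi hj
    have := h.st_I_or_live (Nat.succ_le_of_lt hij) hj.1.le
      ((h.level_succ_eq hij hj.1.le he).symm.trans he) hi.2.2
    rcases this with h1 | h1
    · have := hj.2.1.1
      simp [h1] at this
    · exact h1.not_pReset hj.2.1

variable (N) in
/-- A bound on the number of values that `u` can compute in a phase. -/
noncomputable def phaseBound (u : V) : ℕ :=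
  (N.compSize u - 1) * (N.weightSums u (N.compSize u - 1)).ncard +
    (N.weightSums u (N.compSize u)).ncard

-- Values computed at one level strictly decrease, hence are distinct, and all lie in
-- `computedValues` of the first configuration at that level where `u` computes.
open Classical in
theorem IsRun.card_computes_level_le [Finite V] (h : N.IsRun conf L) (u : N.NonRoot) (k : ℕ) :
    ((Finset.range L).filter fun i => Computes (conf i) (conf (i + 1)) u ∧
      level (conf i) u = k).card ≤ N.phaseBound u := by
  set s := (Finset.range L).filter fun i => Computes (conf i) (conf (i + 1)) u ∧
      level (conf i) u = k with hs
  rcases s.eq_empty_or_nonempty with h0 | h0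
  · simp [h0]
  have hm := s.min'_mem h0
  set m := s.min' h0 with hm'
  have hmem : ∀ i ∈ s, i < L ∧ Computes (conf i) (conf (i + 1)) u ∧ level (conf i) u = k := by
    intro i hi
    simpa [hs] using hi
  refine le_trans ?_ (ncard_computedValues_le (conf m) u)
  rw [Set.ncard_eq_toFinset_card _ (finite_computedValues (conf m) u)]
  refine Finset.card_le_card_of_forall_lt_ne (fun i => d (conf (i + 1)) u) ?_ ?_
  · intro i hi
    rw [Set.Finite.mem_toFinset]
    refine (h.allSourced (s.min'_le i hi) (hmem i hi).1.le ?_).mem_computedValues (hmem i hi).2.1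
    rw [(hmem i hi).2.2, (hmem m hm).2.2]
  · intro i hi j hj hij
    have he : level (conf i) u = level (conf j) u := by rw [(hmem i hi).2.2, (hmem j hj).2.2]
    have hC : Live (conf (i + 1)) u := by
      obtain ⟨_, _, _, hC, _⟩ := (hmem i hi).2.1
      exact .inl hC
    obtain ⟨h1, h2⟩ := h.live (Nat.succ_le_of_lt hij) (hmem j hj).1.le
      ((h.level_succ_eq hij (hmem j hj).1.le he).symm.trans he) hC
    exact ((h1.d_lt_of_computes (hmem j hj).2.1).trans_le h2).ne'

-- At the top level every non-root process of the component is an alive abnormal root. A computation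
-- makes `u` coherent, which ends the phase at once.
open Classical in
theorem IsRun.card_computes_top_level_le [Finite V] (h : N.IsRun conf L) (u : N.NonRoot) :
    ((Finset.range L).filter fun i => Computes (conf i) (conf (i + 1)) u ∧
      level (conf i) u = N.compSize u).card ≤ 1 := by
  refine (Finset.card_le_card_of_forall_lt_ne (t := {()}) (fun _ => ()) (by simp) ?_).trans
    (by simp)
  intro i hi j hj hij
  simp only [Finset.mem_filter, Finset.mem_range] at hi hj
  have he : level (conf i) u = level (conf j) u := by rw [hi.2.2, hj.2.2]
  have hu : (u : V) ∈ aliveSet (conf (i + 1)) u := by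
    have : aliveSet (conf (i + 1)) u = N.component (u : V) \ {N.root} :=
      Set.eq_of_subset_of_ncard_le (aliveSet_subset _ _)
        (hi.2.2.symm.trans (h.level_succ_eq hij hj.1.le he)).le
    rw [this]
    exact ⟨.refl _, u.2⟩
  obtain ⟨v, h1, h2, h3, h4, h5, -⟩ := hi.2.1
  exact absurd hu.2.2.1 ((h i hi.1).not_abRoot_of_compute h2 h3 h4 h5)

-- The moves are sorted by level; the levels below the top each cost `phaseBound`, the top level
-- costs 1.
open Classical in
theorem IsRun.card_computes_le [Finite V] (h : N.IsRun conf L) (u : N.NonRoot) :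
    ((Finset.range L).filter fun i => Computes (conf i) (conf (i + 1)) u).card ≤
      N.compSize u * N.phaseBound u + 1 := by
  rw [Finset.card_eq_sum_card_fiberwise (f := fun i => level (conf i) u)
    (t := Finset.range (N.compSize u + 1))
    (fun i _ => Finset.mem_coe.2 (Finset.mem_range.2 (Nat.lt_succ_of_le (level_le _ _)))),
    Finset.sum_range_succ]
  simp only [Finset.filter_filter]
  refine Nat.add_le_add ?_ (h.card_computes_top_level_le u)
  refine (Finset.sum_le_card_nsmul _ _ _ fun k _ => h.card_computes_level_le u k).trans ?_
  simp

variable (N) in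
/-- A bound on the number of moves of `u` in a run. -/
noncomputable def moveBound (u : V) : ℕ := N.compSize u * N.phaseBound u + 3 * N.compSize u + 2

open Classical in
theorem IsRun.card_moves_le [Finite V] (h : N.IsRun conf L) (u : N.NonRoot) :
    ((Finset.range L).filter fun i => conf (i + 1) u ≠ conf i u).card ≤ N.moveBound u := by
  have hsub : ((Finset.range L).filter fun i => conf (i + 1) u ≠ conf i u) ⊆
      ((Finset.range L).filter fun i => st (conf i) u = Status.C ∧
        st (conf (i + 1)) u = Status.EB) ∪
      (((Finset.range L).filter fun i => st (conf i) u = Status.EB ∧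
        st (conf (i + 1)) u = Status.EF) ∪
      (((Finset.range L).filter fun i => PReset (conf i) u ∧ st (conf (i + 1)) u = Status.I) ∪
      ((Finset.range L).filter fun i => Computes (conf i) (conf (i + 1)) u))) := by
    intro i hi
    simp only [Finset.mem_filter, Finset.mem_range, Finset.mem_union] at hi ⊢
    rcases (h i hi.1).move_of_ne hi.2 with h1 | h1 | h1 | h1
    · exact .inl ⟨hi.1, h1⟩
    · exact .inr (.inl ⟨hi.1, h1⟩)
    · exact .inr (.inr (.inl ⟨hi.1, h1⟩))
    · exact .inr (.inr (.inr ⟨hi.1, h1⟩))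
  refine (Finset.card_le_card hsub).trans ?_
  have h1 := h.card_EB_le (u : V)
  have h2 := h.card_EF_le (u : V)
  have h3 := h.card_I_le (u : V)
  have h4 := h.card_computes_le u
  refine (Finset.card_union_le _ _).trans ?_
  refine (Nat.add_le_add_left ((Finset.card_union_le _ _).trans
    (Nat.add_le_add_left (Finset.card_union_le _ _) _)) _).trans ?_
  simp only [moveBound]
  omega

-- Every step changes the state of at least one process, so the steps are covered by the moves of
-- the individual processes.
open Classical in
theorem IsRun.length_le [Fintype V] (h : N.IsRun conf L) :
    L ≤ ∑ u : N.NonRoot, N.moveBound u := by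
  have hsub : Finset.range L ⊆ Finset.univ.biUnion fun u : N.NonRoot =>
      (Finset.range L).filter fun i => conf (i + 1) u ≠ conf i u := by
    intro i hi
    obtain ⟨u, hu⟩ := (h i (Finset.mem_range.1 hi)).exists_ne
    simp only [Finset.mem_biUnion, Finset.mem_univ, true_and, Finset.mem_filter]
    exact ⟨u, hi, hu⟩
  calc L = (Finset.range L).card := by simp
    _ ≤ _ := Finset.card_le_card hsub
    _ ≤ _ := Finset.card_biUnion_le
    _ ≤ _ := Finset.sum_le_sum fun u _ => h.card_moves_le u

/-! ### Integer weights -/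

theorem exists_nat_wMax [Fintype V] (h : ∀ e ∈ N.graph.edgeSet, ∃ k : ℕ, N.weight e = k) :
    ∃ M : ℕ, N.wMax = M ∧
      ∀ e ∈ N.graph.edgeSet, ∃ k : ℕ, 1 ≤ k ∧ k ≤ M ∧ N.weight e = k := by
  obtain ⟨M, hM⟩ : ∃ M : ℕ, N.wMax = M := by
    rcases (Set.toFinite N.graph.edgeSet).toFinset.eq_empty_or_nonempty with h0 | h0
    · exact ⟨0, by simp [wMax, h0]⟩
    · obtain ⟨e, he, hs⟩ := Finset.exists_mem_eq_sup _ h0 N.weight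
      rw [Set.Finite.mem_toFinset] at he
      obtain ⟨k, hk⟩ := h e he
      exact ⟨k, by rw [wMax, hs, hk]⟩
  refine ⟨M, hM, fun e he => ?_⟩
  obtain ⟨k, hk⟩ := h e he
  have h1 := N.weight_pos e he
  have h2 : N.weight e ≤ N.wMax := Finset.le_sup (f := N.weight) (by simpa using he)
  rw [hk] at h1 h2
  rw [hM] at h2
  exact ⟨k, by exact_mod_cast h1, by exact_mod_cast h2, hk⟩

theorem exists_nat_list_sum {M : ℕ} {l : List ℝ≥0}
    (hl : ∀ b ∈ l, ∃ k : ℕ, 1 ≤ k ∧ k ≤ M ∧ b = k) :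
    ∃ k : ℕ, l.length ≤ k ∧ k ≤ l.length * M ∧ l.sum = k := by
  induction l with
  | nil => exact ⟨0, by simp⟩
  | cons a l ih =>
    obtain ⟨k, h1, h2, h3⟩ := ih fun b hb => hl b (List.mem_cons_of_mem _ hb)
    obtain ⟨m, h4, h5, h6⟩ := hl a List.mem_cons_self
    refine ⟨m + k, by simp; omega, ?_, by simp [h3, h6]⟩
    rw [List.length_cons, add_mul, one_mul]
    omega

/-- Such a sum is an integer between 1 and `k * M`. -/
theorem ncard_weightSums_le {M : ℕ}
    (h : ∀ e ∈ N.graph.edgeSet, ∃ k : ℕ, 1 ≤ k ∧ k ≤ M ∧ N.weight e = k) (c : V) (k : ℕ) :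
    (N.weightSums c k).ncard ≤ k * M := by
  have hsub : N.weightSums c k ⊆ ((Finset.Icc 1 (k * M)).image (Nat.cast : ℕ → ℝ≥0) : Finset ℝ≥0) := by
    rintro _ ⟨l, h1, h2, h3, rfl⟩
    obtain ⟨m, h4, h5, h6⟩ := exists_nat_list_sum (M := M) (l := l) (by
      intro b hb
      obtain ⟨v, w, hvw, -, rfl⟩ := h3 b hb
      exact h _ hvw)
    rw [Finset.coe_image]
    refine ⟨m, Finset.mem_coe.2 (Finset.mem_Icc.2 ⟨h1.trans h4, h5.trans ?_⟩), h6.symm⟩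
    gcongr
  refine (Set.ncard_le_ncard hsub (Finset.finite_toSet _)).trans ?_
  rw [Set.ncard_coe_finset]
  exact Finset.card_image_le.trans (by simp)

/-- A component with a single non-root process has at most one edge, the one to the root. The
general estimate `M` would be too weak for the final bound in this case. -/
theorem ncard_weightSums_one_le [Finite V] (u : N.NonRoot) (hu : N.compSize u = 1) :
    (N.weightSums u 1).ncard ≤ 1 := by
  have huv : ∀ v, N.graph.Reachable u v → v = u ∨ v = N.root := by
    intro v hv
    by_contra hc
    push Not at hc
    obtain ⟨a, ha⟩ := Set.ncard_eq_one.1 hu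
    have h1 : v ∈ ({a} : Set V) := ha ▸ ⟨hv, hc.2⟩
    have h2 : (u : V) ∈ ({a} : Set V) := ha ▸ ⟨.refl _, u.2⟩
    exact hc.1 (h1.trans h2.symm)
  refine (Set.ncard_le_ncard (t := {N.edgeWeight u N.root}) ?_).trans (by simp)
  rintro _ ⟨l, h1, h2, h3, rfl⟩
  obtain ⟨a, rfl⟩ := List.length_eq_one_iff.1 (le_antisymm h2 h1)
  obtain ⟨v, w, hvw, hv, hav⟩ := h3 a (by simp)
  have hw := hv.trans hvw.reachable
  rw [List.sum_singleton, Set.mem_singleton_iff, hav]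
  rcases huv v hv with rfl | rfl <;> rcases huv w hw with h | rfl
  · exact absurd h.symm hvw.ne
  · rfl
  · rw [h, edgeWeight_comm]
  · exact absurd rfl hvw.ne

theorem moveBound_le_compSize [Finite V] {M : ℕ}
    (h : ∀ e ∈ N.graph.edgeSet, ∃ k : ℕ, 1 ≤ k ∧ k ≤ M ∧ N.weight e = k) (u : N.NonRoot) :
    N.moveBound u ≤ (N.compSize u + 1) * (M * N.compSize u * (N.compSize u - 1) + 3) := by
  have h0 : 0 < N.compSize u := Set.ncard_pos (Set.toFinite _) |>.2 ⟨u, .refl _, u.2⟩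
  obtain ⟨n, hn⟩ : ∃ n, N.compSize u = n + 1 := ⟨N.compSize u - 1, by omega⟩
  rcases n with _ | k
  · have h1 := ncard_weightSums_one_le u (by simpa using hn)
    simp only [moveBound, phaseBound, hn]
    simp only [zero_add, Nat.sub_self, zero_mul, one_mul, mul_zero]
    omega
  · have h1 := ncard_weightSums_le h (u : V) (k + 1)
    have h2 := ncard_weightSums_le h (u : V) (k + 1 + 1)
    simp only [moveBound, phaseBound, hn, Nat.add_sub_cancel]
    calc _ ≤ (k + 1 + 1) * ((k + 1) * ((k + 1) * M) + (k + 1 + 1) * M) + 3 * (k + 1 + 1) + 2 := by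
          gcongr
      -- The added term is the exact slack between the two bounds; it is nonnegative because
      -- `compSize u = k + 2` here.
      _ ≤ (k + 1 + 1) * ((k + 1) * ((k + 1) * M) + (k + 1 + 1) * M) + 3 * (k + 1 + 1) + 2 +
          (M * (k + 2) * k + 1) := Nat.le_add_right _ _
      _ = _ := by ring

theorem compSize_le_nMaxCC [Fintype V] (u : V) : N.compSize u ≤ N.nMaxCC :=
  Finset.le_sup (f := fun u : V => (N.component u \ {N.root}).ncard) (Finset.mem_univ u)

theorem card_nonRoot [Fintype V] [Fintype N.NonRoot] : Fintype.card N.NonRoot = Fintype.card V - 1 := by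
  classical
  simp

theorem IsRun.length_le_of_nat [Fintype V] {M : ℕ} {conf : ℕ → N.Config} {L : ℕ}
    (h : ∀ e ∈ N.graph.edgeSet, ∃ k : ℕ, 1 ≤ k ∧ k ≤ M ∧ N.weight e = k) (hr : N.IsRun conf L) :
    L ≤ (Fintype.card V - 1) * ((N.nMaxCC + 1) * (M * N.nMaxCC * (N.nMaxCC - 1) + 3)) := by
  classical
  refine hr.length_le.trans ?_
  rw [← card_nonRoot (N := N), ← smul_eq_mul]
  refine Finset.sum_le_card_nsmul _ _ _ fun u _ => (moveBound_le_compSize h u).trans ?_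
  have := compSize_le_nMaxCC (N := N) u
  gcongr

theorem Execution.length_le {B : ℕ}
    (hB : ∀ (conf : ℕ → N.Config) (L : ℕ), N.IsRun conf L → L ≤ B) (e : N.Execution) :
    e.length ≤ B := by
  by_contra hc
  push Not at hc
  refine absurd (hB e.conf (B + 1) fun i hi => e.step i (lt_of_le_of_lt ?_ hc)) (by omega)
  exact_mod_cast Nat.lt_succ_iff.1 hi

/-! ### Terminal configurations -/

theorem exists_computePath [Finite V] {u : V} (h : ∃ v, N.graph.Adj u v ∧ st γ v = Status.C) :
    ∃ s, ComputePath γ u s := by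
  obtain ⟨v, hv, hmin⟩ := Set.exists_min_image {v | N.graph.Adj u v ∧ st γ v = Status.C}
    (fun v => d γ v + N.edgeWeight u v) (Set.toFinite _) h
  exact ⟨_, v, hv, fun w hw hw' => hmin w ⟨hw, hw'⟩, rfl⟩

theorem Enabled.exists_step [Finite V] {u : N.NonRoot} (h : Enabled γ u) : ∃ γ', Step γ γ' := by
  classical
  obtain ⟨ρ, hρ⟩ := h
  obtain ⟨s, hs⟩ : ∃ s, Action γ u ρ s := by
    cases ρ with
    | RC =>
      obtain ⟨v, h1, h2, -⟩ := hρ.2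
      exact exists_computePath ⟨v, h1, h2⟩
    | REB => exact ⟨_, rfl⟩
    | REF => exact ⟨_, rfl⟩
    | RI => exact ⟨_, rfl⟩
    | RR => exact exists_computePath hρ.2
  refine ⟨Function.update γ u s, {u}, by simp, ?_, fun v hv => ?_⟩
  · rintro _ rfl
    exact ⟨ρ, hρ, by simpa using hs⟩
  · exact Function.update_of_ne hv _ _

/-- Runs have bounded length, so steps are well-founded, and a configuration from which no step
starts has no enabled process. -/
theorem exists_terminal [Fintype V] [Nonempty Lbl] : ∃ γ : N.Config, Terminal γ := by
  classical
  have hwf : WellFounded fun γ' γ : N.Config => Step γ γ' := by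
    refine wellFounded_iff_isEmpty_descending_chain.2 ⟨fun ⟨f, hf⟩ => ?_⟩
    have : N.IsRun f ((∑ u : N.NonRoot, N.moveBound u) + 1) := fun i _ => hf i
    have := this.length_le
    omega
  obtain ⟨l⟩ := ‹Nonempty Lbl›
  obtain ⟨γ, -, hγ⟩ := hwf.has_min Set.univ ⟨fun _ => ⟨Status.I, l, 0⟩, trivial⟩
  refine ⟨γ, fun u hu => ?_⟩
  obtain ⟨γ', h⟩ := hu.exists_step
  exact hγ γ' trivial h

theorem Terminal.not_guard (h : Terminal γ) (hu : u ≠ N.root) (ρ : Rule) :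
    ¬ Guard γ ⟨u, hu⟩ ρ := fun hg => h ⟨u, hu⟩ ⟨ρ, hg⟩

theorem ne_root_of_st_ne (h : st γ u ≠ Status.C) : u ≠ N.root := by
  rintro rfl
  exact h (st_root γ)

theorem Terminal.st_ne_EB [Finite V] (h : Terminal γ) (u : V) : st γ u ≠ Status.EB := by
  intro hu
  -- For an `EB` process of maximal distance, disabled `REF` yields a child of larger distance not
  -- in `EF`. It is not in `EB` by maximality, and in `C` it could execute `RC` or `REB`.
  obtain ⟨u, hu, hmax⟩ := Set.exists_max_image {u | st γ u = Status.EB} (d γ) (Set.toFinite _)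
    ⟨u, hu⟩
  have hu : st γ u = Status.EB := hu
  have hur : u ≠ N.root := ne_root_of_st_ne (γ := γ) (by simp [hu])
  have hg := h.not_guard hur Rule.REF
  simp only [Guard, hu, true_and] at hg
  push Not at hg
  obtain ⟨v, ⟨hadj, -, hI, hp, hd, -⟩, hEF⟩ := hg
  have hlt : d γ u < d γ v := (lt_add_of_pos_right _ (edgeWeight_pos hp.1)).trans_le hd
  rcases hv : st γ v
  · exact hI hv
  · have h1 := h.not_guard hp.ne_root Rule.RC
    have h2 := h.not_guard hp.ne_root Rule.REB
    simp only [Guard, hv, true_and] at h1 h2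
    exact h2 ⟨h1, .inr ⟨u, hp, hu⟩⟩
  · exact absurd (hmax v hv) (not_le.2 hlt)
  · exact hEF hv

/-- An abnormal root in `EF` could execute `RI` or `RR`. Otherwise, as `EB` is absent, the parent is
in `EF` with a smaller distance, and descent concludes. -/
theorem Terminal.st_ne_EF [Finite V] (h : Terminal γ) (u : V) : st γ u ≠ Status.EF := by
  refine induction_d γ (P := fun u => st γ u ≠ Status.EF) (fun u ih hu => ?_) u
  have hur : u ≠ N.root := ne_root_of_st_ne (γ := γ) (by simp [hu])
  have hna : ¬ AbRoot γ u := by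
    intro ha
    have h1 := h.not_guard hur Rule.RI
    have h2 := h.not_guard hur Rule.RR
    simp only [Guard, PReset, hu, ha, true_and, true_or] at h1 h2
    push Not at h1
    exact h2 h1
  obtain ⟨v, hp, -, hd, hs⟩ := (not_abRoot_iff (by simp [hu])).1 hna
  have hs := hs.resolve_right (h.st_ne_EB v)
  exact ih v ((lt_add_of_pos_right _ (edgeWeight_pos hp.1)).trans_le hd) (hs.symm.trans hu)

theorem Terminal.st_eq [Finite V] (h : Terminal γ) (u : V) :
    st γ u = Status.I ∨ st γ u = Status.C := by
  rcases hu : st γ u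
  · exact .inl rfl
  · exact .inr rfl
  · exact absurd hu (h.st_ne_EB u)
  · exact absurd hu (h.st_ne_EF u)

theorem Terminal.d_le [Finite V] (h : Terminal γ) (hu : st γ u = Status.C)
    (hv : st γ v = Status.C) (huv : N.graph.Adj u v) : d γ u ≤ d γ v + N.edgeWeight u v := by
  by_cases hur : u = N.root
  · simp [hur, d_root]
  · by_contra hc
    exact h.not_guard hur Rule.RC ⟨hu, v, huv, hv, not_le.1 hc⟩

theorem Terminal.exists_parent [Finite V] (h : Terminal γ) (hu : st γ u = Status.C)
    (hur : u ≠ N.root) :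
    ∃ v, ParIs γ u v ∧ st γ v = Status.C ∧ d γ u = d γ v + N.edgeWeight u v := by
  have h1 := h.not_guard hur Rule.RC
  have h2 := h.not_guard hur Rule.REB
  simp only [Guard, hu, true_and] at h1 h2
  have hna : ¬ AbRoot γ u := fun ha => h2 ⟨h1, .inl ha⟩
  obtain ⟨v, hp, hI, hd, -⟩ := (not_abRoot_iff (by simp [hu])).1 hna
  have hv := (h.st_eq v).resolve_left hI
  exact ⟨v, hp, hv, le_antisymm (h.d_le hu hv hp.1) hd⟩

theorem Terminal.st_C_of_adj [Finite V] (h : Terminal γ) (hv : st γ v = Status.C)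
    (huv : N.graph.Adj u v) : st γ u = Status.C := by
  refine (h.st_eq u).resolve_left fun hu => ?_
  have hur : u ≠ N.root := ne_root_of_st_ne (γ := γ) (by simp [hu])
  exact h.not_guard hur Rule.RR ⟨.inr hu, v, huv, hv⟩

theorem Terminal.st_C_and_d_le [Finite V] (h : Terminal γ) (p : N.graph.Walk u v)
    (hv : v = N.root) : st γ u = Status.C ∧ d γ u ≤ N.walkWeight p := by
  induction p with
  | nil => subst hv; exact ⟨st_root γ, by simp [d_root]⟩
  | @cons a b c hab q ih =>
    obtain ⟨h1, h2⟩ := ih hv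
    have ha := h.st_C_of_adj h1 hab
    refine ⟨ha, (h.d_le ha h1 hab).trans ?_⟩
    rw [walkWeight, SimpleGraph.Walk.edges_cons, List.map_cons, List.sum_cons, add_comm]
    exact add_le_add le_rfl h2

theorem sum_bypass_le {W : Type*} [DecidableEq W] {G : SimpleGraph W} (g : Sym2 W → ℝ≥0) {a b : W}
    (p : G.Walk a b) : (p.bypass.edges.map g).sum ≤ (p.edges.map g).sum :=
  (p.edges_bypass_sublist_edges.map g).sum_le_sum (by simp)

theorem wdist_le_walkWeight (p : N.graph.Walk u v) : N.wdist u v ≤ N.walkWeight p := by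
  classical
  refine (iInf_le _ p.toPath).trans ?_
  exact_mod_cast sum_bypass_le N.weight p

/-- Parents of status `C` are followed with strictly decreasing distance until the root. This gives
one half of the distance equality and also excludes status `C` outside the root's component. -/
theorem Terminal.exists_walk [Finite V] (h : Terminal γ) (hu : st γ u = Status.C) :
    ∃ p : N.graph.Walk u N.root, N.walkWeight p = d γ u := by
  revert hu
  refine induction_d γ (P := fun u => st γ u = Status.C →
    ∃ p : N.graph.Walk u N.root, N.walkWeight p = d γ u) (fun u ih hu => ?_) u
  by_cases hur : u = N.root
  · subst hur
    exact ⟨.nil, by simp [walkWeight, d_root]⟩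
  · obtain ⟨v, hp, hv, hd⟩ := h.exists_parent hu hur
    obtain ⟨p, hpw⟩ := ih v (hd ▸ lt_add_of_pos_right _ (edgeWeight_pos hp.1)) hv
    refine ⟨.cons hp.1 p, ?_⟩
    rw [hd, ← hpw, walkWeight, SimpleGraph.Walk.edges_cons, List.map_cons, List.sum_cons, add_comm]
    rfl

theorem Terminal.legitimate [Finite V] (h : Terminal γ) : γ ∈ N.legitimate := by
  intro u
  by_cases hur : u = N.root
  · exact .inl hur
  right
  by_cases hc : u ∈ N.component N.root
  · obtain ⟨p⟩ : N.graph.Reachable u N.root := SimpleGraph.Reachable.symm hc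
    have hu := (h.st_C_and_d_le p rfl).1
    obtain ⟨v, hp, -, hd⟩ := h.exists_parent hu hur
    refine .inl ⟨hur, hc, hu, le_antisymm ?_ ?_, v, hp, hd⟩
    · exact le_iInf fun q => ENNReal.coe_le_coe.2 (h.st_C_and_d_le q.1 rfl).2
    · obtain ⟨q, hq⟩ := h.exists_walk hu
      rw [← hq]
      exact wdist_le_walkWeight q
  · refine .inr ⟨hc, (h.st_eq u).resolve_right fun hu => hc ?_⟩
    obtain ⟨q, -⟩ := h.exists_walk hu
    exact q.reachable.symm

/-! ### The shortest-path tree of a legitimate configuration -/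

theorem wdist_root_root : N.wdist N.root N.root = 0 := by
  simpa [walkWeight] using wdist_le_walkWeight (N := N) (SimpleGraph.Walk.nil : N.graph.Walk N.root N.root)

theorem coe_d_of_legitimate (h : γ ∈ N.legitimate) (hu : u ∈ N.component N.root) :
    (d γ u : ℝ≥0∞) = N.wdist u N.root := by
  rcases h u with rfl | ⟨-, -, -, h, -⟩ | ⟨h, -⟩
  · simp [d_root, wdist_root_root]
  · exact h
  · exact absurd hu h

theorem exists_parent_of_legitimate (h : γ ∈ N.legitimate) (hu : u ∈ N.component N.root)
    (hur : u ≠ N.root) : ∃ v ∈ N.component N.root, ParIs γ u v ∧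
      d γ u = d γ v + N.edgeWeight u v := by
  rcases h u with h | ⟨-, -, -, -, v, hv, hd⟩ | ⟨h, -⟩
  · exact absurd h hur
  · exact ⟨v, SimpleGraph.Reachable.trans hu hv.1.reachable, hv, hd⟩
  · exact absurd hu h

theorem exists_walk_parentGraph [Finite V] (h : γ ∈ N.legitimate)
    (r : (parentGraph γ).verts) (hr : (r : V) = N.root) (u : (parentGraph γ).verts) :
    ∃ p : (parentGraph γ).coe.Walk u r, N.walkWeight (p.map (parentGraph γ).hom) = d γ u := by
  obtain ⟨u, hu⟩ := u
  revert hu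
  refine induction_d γ (P := fun u => ∀ hu : u ∈ (parentGraph γ).verts,
    ∃ p : (parentGraph γ).coe.Walk ⟨u, hu⟩ r,
      N.walkWeight (p.map (parentGraph γ).hom) = d γ u) (fun u ih hu => ?_) u
  by_cases hur : u = N.root
  · obtain ⟨r, hr'⟩ := r
    simp only at hr
    subst hur
    subst hr
    exact ⟨.nil, by simp [walkWeight, d_root]⟩
  · obtain ⟨v, hv, hp, hd⟩ := exists_parent_of_legitimate h hu hur
    obtain ⟨p, hpw⟩ := ih v (hd ▸ lt_add_of_pos_right _ (edgeWeight_pos hp.1)) hv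
    have hadj : (parentGraph γ).coe.Adj ⟨u, hu⟩ ⟨v, hv⟩ := Or.inl ⟨hu, hur, hp⟩
    refine ⟨.cons hadj p, ?_⟩
    rw [hd, ← hpw, walkWeight, SimpleGraph.Walk.map_cons, SimpleGraph.Walk.edges_cons,
      List.map_cons, List.sum_cons, add_comm]
    rfl

theorem isTree_parentGraph [Finite V] (h : γ ∈ N.legitimate) : (parentGraph γ).coe.IsTree := by
  have hrm : N.root ∈ (parentGraph γ).verts := .refl _
  rw [SimpleGraph.isTree_iff_connected_and_card]
  have hconn : (parentGraph γ).coe.Connected := by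
    have : Nonempty (parentGraph γ).verts := ⟨⟨N.root, hrm⟩⟩
    refine ⟨fun a b => ?_⟩
    obtain ⟨p, -⟩ := exists_walk_parentGraph h ⟨N.root, hrm⟩ rfl a
    obtain ⟨q, -⟩ := exists_walk_parentGraph h ⟨N.root, hrm⟩ rfl b
    exact p.reachable.trans q.reachable.symm
  refine ⟨hconn, le_antisymm ?_ hconn.card_vert_le_card_edgeSet_add_one⟩
  have hpar : ∀ u : (parentGraph γ).verts, ∃ v : (parentGraph γ).verts,
      (u : V) ≠ N.root → ParIs γ u v := by
    intro u
    by_cases hur : (u : V) = N.root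
    · exact ⟨u, fun h => absurd hur h⟩
    · obtain ⟨v, hv, hp, -⟩ := exists_parent_of_legitimate h u.2 hur
      exact ⟨⟨v, hv⟩, fun _ => hp⟩
  choose f hf using hpar
  -- Each edge is the parent edge of some non-root vertex, so there are at most `|V_r| - 1` edges;
  -- with connectedness this forces a tree.
  have hsub : (parentGraph γ).coe.edgeSet ⊆ (fun u => s(u, f u)) '' (Set.univ \ {⟨N.root, hrm⟩}) := by
    intro e
    induction e with
    | h a b =>
      rintro (⟨-, hr, hp⟩ | ⟨-, hr, hp⟩)
      · refine ⟨a, ⟨trivial, fun h => hr (congrArg Subtype.val h)⟩, ?_⟩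
        have : f a = b := Subtype.ext ((hf a hr).unique hp)
        simp [this]
      · refine ⟨b, ⟨trivial, fun h => hr (congrArg Subtype.val h)⟩, ?_⟩
        have : f b = a := Subtype.ext ((hf b hr).unique hp)
        simp [this, Sym2.eq_swap]
  have hle := (Set.ncard_le_ncard hsub (Set.toFinite _)).trans (Set.ncard_image_le (Set.toFinite _))
  rw [Set.ncard_sdiff_singleton_of_mem (Set.mem_univ _), Set.ncard_univ] at hle
  have hpos : 0 < Nat.card (parentGraph γ).verts := Nat.card_pos_iff.2 ⟨⟨⟨N.root, hrm⟩⟩, inferInstance⟩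
  rw [Nat.card_coe_set_eq (parentGraph γ).coe.edgeSet]
  omega

theorem isShortestPathTree_parentGraph [Finite V] (h : γ ∈ N.legitimate) :
    N.IsShortestPathTree (parentGraph γ) := by
  classical
  refine ⟨rfl, isTree_parentGraph h, fun u r p hr => le_antisymm ?_ ?_⟩
  · obtain ⟨q, hq⟩ := exists_walk_parentGraph h r hr u
    -- Paths in a tree are unique, so `p` is the loop-erased walk of parents, whose weight is at
    -- most `d γ u`.
    rw [hr, ← coe_d_of_legitimate h u.2, ← hq,
      ((isTree_parentGraph h).isAcyclic.subsingleton_path u r).elim p q.toPath, ENNReal.coe_le_coe]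
    simp only [walkWeight, SimpleGraph.Walk.edges_map, List.map_map]
    exact sum_bypass_le _ q
  · exact wdist_le_walkWeight _

theorem st_eq_I_of_legitimate (h : γ ∈ N.legitimate) (hu : u ∉ N.component N.root) :
    st γ u = Status.I := by
  rcases h u with rfl | ⟨-, h, -⟩ | ⟨-, h⟩
  · exact absurd (SimpleGraph.Reachable.refl _) hu
  · exact absurd h hu
  · exact h

/-! ### Silent self-stabilization, stabilization time and the main theorem -/

theorem silentSelfStabilizing [Fintype V] [Nonempty Lbl] :
    SilentSelfStabilizing N.distributedUnfair N.legitimate := by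
  classical
  refine ⟨?_, fun e _ he => ?_, fun γ h => h.legitimate⟩
  · obtain ⟨γ, h⟩ := exists_terminal (N := N)
    exact ⟨γ, h.legitimate⟩
  · have := e.length_le (B := ∑ u : N.NonRoot, N.moveBound u) fun _ _ h => h.length_le
    exact absurd (he ▸ this) (by simp)

theorem exists_stabilizationTime_eq [Fintype V] {M : ℕ}
    (h : ∀ e ∈ N.graph.edgeSet, ∃ k : ℕ, 1 ≤ k ∧ k ≤ M ∧ N.weight e = k) :
    ∃ T : ℕ, stabilizationTime N.distributedUnfair = T ∧
      T ≤ (Fintype.card V - 1) * ((N.nMaxCC + 1) * (M * N.nMaxCC * (N.nMaxCC - 1) + 3)) := by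
  have hle : stabilizationTime N.distributedUnfair ≤
      (((Fintype.card V - 1) * ((N.nMaxCC + 1) * (M * N.nMaxCC * (N.nMaxCC - 1) + 3)) : ℕ) : ℕ∞) :=
    iSup₂_le fun e _ => e.length_le fun _ _ hr => hr.length_le_of_nat h
  obtain ⟨T, hT⟩ := ENat.ne_top_iff_exists.1 (ne_top_of_le_ne_top (ENat.natCast_ne_top _) hle)
  refine ⟨T, hT.symm, ?_⟩
  rw [← hT] at hle
  exact_mod_cast hle

theorem one_le_nMaxCC [Fintype V] (h : N.graph.edgeSet.Nonempty) : 1 ≤ N.nMaxCC := by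
  obtain ⟨e, he⟩ := h
  induction e with
  | h a b =>
    have he : N.graph.Adj a b := he
    have : ∀ u, u ≠ N.root → 1 ≤ N.nMaxCC := fun u hu =>
      (Nat.succ_le_of_lt ((Set.ncard_pos (Set.toFinite _)).2
        (show (N.component u \ {N.root}).Nonempty from ⟨u, .refl _, hu⟩))).trans
        (compSize_le_nMaxCC u)
    by_cases ha : a = N.root
    · exact this b fun hb => he.ne (ha.trans hb.symm)
    · exact this a ha

end Network
end RSP

open RSP RSP.Network in
theorem mainTheorem1 :
    ∃ K : ℝ, ∀ (V : Type*) [Fintype V] (Lbl : Type*) [Nonempty Lbl] (N : Network V Lbl),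
      SilentSelfStabilizing N.distributedUnfair N.legitimate ∧
      (∀ γ ∈ N.legitimate,
        N.IsShortestPathTree (parentGraph γ) ∧ ∀ u ∉ N.component N.root, st γ u = Status.I) ∧
      ((∀ e ∈ N.graph.edgeSet, ∃ k : ℕ, N.weight e = k) →
        ∃ T : ℕ, stabilizationTime N.distributedUnfair = T ∧
          (T : ℝ) ≤ ((N.wMax : ℝ) * (N.nMaxCC : ℝ) ^ 3 + (3 - (N.wMax : ℝ)) * (N.nMaxCC : ℝ) + 3)
            * ((Fintype.card V : ℝ) - 1) ∧
          (N.graph.edgeSet.Nonempty →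
            (T : ℝ) ≤ K * ((N.wMax : ℝ) * (N.nMaxCC : ℝ) ^ 3 * (Fintype.card V : ℝ)))) := by
  -- The constant 7 is 1 + 3 + 3: with at least one edge, `M` and `nMaxCC` are at least 1, so `3 *
  -- nMaxCC` and 3 are each at most `3 * M * nMaxCC ^ 3`.
  refine ⟨7, fun V _ Lbl _ N => ⟨silentSelfStabilizing, fun γ h =>
    ⟨isShortestPathTree_parentGraph h, fun u => st_eq_I_of_legitimate h⟩, fun h => ?_⟩⟩
  obtain ⟨M, hM, hw⟩ := exists_nat_wMax h
  obtain ⟨T, hT, hle⟩ := exists_stabilizationTime_eq hw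
  have hV : 1 ≤ Fintype.card V := Fintype.card_pos_iff.2 ⟨N.root⟩
  have hbound : (T : ℝ) ≤ ((M : ℝ) * (N.nMaxCC : ℝ) ^ 3 + (3 - (M : ℝ)) * (N.nMaxCC : ℝ) + 3)
      * ((Fintype.card V : ℝ) - 1) := by
    refine (Nat.cast_le.2 hle).trans_eq ?_
    -- The case `nMaxCC = 0` is separated because `nMaxCC - 1` is a truncated subtraction; its
    -- factor `nMaxCC` vanishes there.
    rcases hn : N.nMaxCC with _ | n
    · simp [Nat.cast_sub hV, mul_comm]
    · simp only [Nat.add_sub_cancel, Nat.cast_mul, Nat.cast_add, Nat.cast_sub hV, Nat.cast_one,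
        Nat.cast_ofNat]
      ring
  have hM' : (N.wMax : ℝ) = M := by simp [hM]
  rw [hM']
  refine ⟨T, hT, hbound, fun hne => hbound.trans ?_⟩
  have hn : (1 : ℝ) ≤ N.nMaxCC := by exact_mod_cast one_le_nMaxCC hne
  have hM1 : (1 : ℝ) ≤ M := by
    obtain ⟨e, he⟩ := hne
    obtain ⟨k, h1, h2, -⟩ := hw e he
    exact_mod_cast h1.trans h2
  have hc : (1 : ℝ) ≤ Fintype.card V := by exact_mod_cast hV
  have h1 : (N.nMaxCC : ℝ) ≤ (N.nMaxCC : ℝ) ^ 3 := le_self_pow₀ hn (by norm_num)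
  have h2 : (N.nMaxCC : ℝ) ^ 3 ≤ M * (N.nMaxCC : ℝ) ^ 3 :=
    le_mul_of_one_le_left (by positivity) hM1
  have h3 : 0 ≤ (M : ℝ) * N.nMaxCC := by positivity
  calc _ ≤ (7 * (M * (N.nMaxCC : ℝ) ^ 3)) * (Fintype.card V : ℝ) := by
        refine mul_le_mul ?_ (by linarith) (by linarith) (by positivity)
        linarith
    _ = _ := by ring
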